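/- Let $p_1<p_2<\cdots$ be the sequence of all primes and let $$E=\Big\{\prod_{1\le i\le k,\ i\ne j}p_i:\ k\ge 2,\ 1\le j\le k\Big\},\qquad \Phi(x)=\frac{x\ln(1+x)}{\ln\ln(3+x)}\quad(x\ge 0).$$ Let $\mathbb T=\mathbb R/\mathbb Z$ with Lebesgue measure $|\cdot|$, let $L^\Phi(\mathbb T)$ be the class of measurable functions $f:\mathbb T\to\mathbb C$ with $\int_{\mathbb T}\Phi(|f|)<\infty$, and for $n\ge 1$ let $$R_nf(x)=\frac1n\sum_{k=0}^{n-1}f\Big(x+\frac kn\Big),\qquad x\in\mathbb T.$$ Then every $f\in L^\Phi(\mathbb T)$ is integrable and satisfies $$\lim_{n\to\infty,\ n\in E}R_nf(x)=\int_0^1 f\quad\text{for almost every }x\in\mathbb T.$$ Moreover, there is an absolute constant $c>0$ such that for every $f\in L^\Phi(\mathbb T)$ and every $\lambda>0$ $$\Big|\Big\{x\in\mathbb T:\ \sup_{n\in E}|R_nf(x)|>\lambda\Big\}\Big|\le\int_0^1\Phi\Big(\frac{c|f|}{\lambda}\Big).$$ -/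

import Mathlib

open MeasureTheory Filter Topology
open scoped ENNReal

namespace RiemannSums

noncomputable section

/-- The set `E` of all products `p₁ ⋯ p_{j-1} p_{j+1} ⋯ p_k` with `k ≥ 2` and `1 ≤ j ≤ k`, where
`p₁ < p₂ < ⋯` are the primes. In Lean the primes are indexed from `0`: `p_{i+1}` is
`Nat.nth Nat.Prime i`. -/
def E : Set ℕ :=
  {n | ∃ k j : ℕ, 2 ≤ k ∧ j < k ∧
    n = ∏ i ∈ (Finset.range k).erase j, Nat.nth Nat.Prime i}

/-- The function `Φ(x) = x ln(1+x) / ln ln(3+x)`, used for `x ≥ 0` only. -/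
def Phi (x : ℝ) : ℝ :=
  x * Real.log (1 + x) / Real.log (Real.log (3 + x))

/-- The Riemann sum `R_n f(x) = (1/n) ∑_{k=0}^{n-1} f(x + k/n)` of a function on `𝕋 = ℝ/ℤ`. -/
def R (n : ℕ) (f : UnitAddCircle → ℂ) (x : UnitAddCircle) : ℂ :=
  (1 / (n : ℂ)) * ∑ k ∈ Finset.range n, f (x + (((k : ℝ) / (n : ℝ) : ℝ) : UnitAddCircle))

/-- The class `L^Φ(𝕋)`: measurable functions `f` with `Φ(|f|) ∈ L¹(𝕋)`. -/
def MemLPhi (f : UnitAddCircle → ℂ) : Prop :=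
  AEStronglyMeasurable f volume ∧ Integrable (fun x => Phi ‖f x‖) volume

/-- The maximal function `sup_{n ∈ E} |R_n f(x)|`, with values in `[0, ∞]`. -/
def maximal (f : UnitAddCircle → ℂ) (x : UnitAddCircle) : ℝ≥0∞ :=
  ⨆ n ∈ E, ‖R n f x‖ₑ

end

end RiemannSums

/-!
For `f ≥ 0` write `g k = R_{P_k} f` and `A k j = R_{P_k / p_j} f`, where `P_k` is the product of
the first `k` primes. By the Chinese remainder theorem, averaging over two coprime moduli is
averaging over their product (`avg_avg`). So the averages over single primes behave like
integrations over independent coordinates, `g` is a reverse martingale in `k`, and, for `k > j`,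
both `A k j` and `g k` arise from `g j` and `g (j + 1)` by one and the same averaging, over the
primes strictly between the indices `j` and `k`.

The heart is an entropy estimate for bounded `f` (`sum_setIntegral_primeAvg_erase_le`). Let
`D_j` be the event that, for some `k > j`, `A k j > lam` while `g k ≤ ε`, with `ε` much smaller
than `lam`. Split by the largest such `k`, each part of `D_j` is invariant under the averaging that
leads from `(g j, g (j + 1))` to `(A k j, g k)`. On it the affine minorant
`s a - (b + ε) eˢ` of the shifted relative entropy `relEnt ε a b` dominates `s A / 2` at
`(a, b) = (A k j, g k)`. Averaging back gives `∫_{D_j} f ≤ (2/s) ∫ relEnt ε (g j) (g (j + 1))`,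
and by the chain rule for the entropy the sum over `j` of the right-hand sides telescopes, to at
most `∫ f log (1 + f / ε)`. The shift by `ε` is essential: without it the entropy spent while `g`
climbs from the possibly minute `∫ f` to the level `ε` would be counted as well. The complementary
event `sup_k g k > ε` has measure at most `∫ f / ε` (`weak_type_primeAvg_range`).

To pass to `L^Φ`, cut `f` into slices with values in `(exp 2^i, exp 2^(i+1)]`, `i ≥ 16`. With
`ε_i = i / 2^i`, `s_i = i / 4` and `lam_i = (4/5)^i`, the slice of index `i` costs a constant times
`2^i / i` times its integral, which is its contribution to `∫ Φ(f)`: the saving of a factor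
`log log f ~ i` over `log f ~ 2^i` comes from the quotient of `log (M_i / ε_i) ~ 2^i` by
`s_i ~ log (lam_i / ε_i) ~ i`. The slices are treated simultaneously, for
a common stopping index (`measure_exists_sum_primeAvg_erase_le`), so that nothing is lost in
summing weak-type bounds. This gives the maximal inequality (`measure_maximal_le`).

Almost everywhere convergence follows from the maximal inequality and the convergence of Riemann
sums of continuous functions, by approximating bounded functions by continuous ones in `L²` and
general functions by their truncations.
-/

namespace RiemannSums

noncomputable section

/-! ### Averages over rational translates -/

instance : IsProbabilityMeasure (volume : Measure UnitAddCircle) := ⟨UnitAddCircle.measure_univ⟩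

/-- The Riemann sum `R n f` for real-valued functions. -/
def avg (n : ℕ) (f : UnitAddCircle → ℝ) (x : UnitAddCircle) : ℝ :=
  (1 / (n : ℝ)) * ∑ k ∈ Finset.range n, f (x + (((k : ℝ) / (n : ℝ) : ℝ) : UnitAddCircle))

/-- `u` is invariant under translation by `1/n`. A set `S` is invariant when `(· ∈ S)` is. -/
def FracPeriodic {β : Type*} (n : ℕ) (u : UnitAddCircle → β) : Prop :=
  ∀ x, u (x + ((1 / (n : ℝ) : ℝ) : UnitAddCircle)) = u x

section Periodic

variable {β : Type*} {n m : ℕ} {u : UnitAddCircle → β}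

lemma FracPeriodic.apply_add_div (hu : FracPeriodic n u) (x : UnitAddCircle) (k : ℕ) :
    u (x + (((k : ℝ) / (n : ℝ) : ℝ) : UnitAddCircle)) = u x := by
  induction k with
  | zero => simp
  | succ k ih =>
    rw [← ih, ← hu (x + (((k : ℝ) / (n : ℝ) : ℝ) : UnitAddCircle)), add_assoc, ← AddCircle.coe_add]
    congr 3
    push_cast
    ring

lemma FracPeriodic.of_dvd (hu : FracPeriodic n u) (hn : n ≠ 0) (h : m ∣ n) : FracPeriodic m u := by
  obtain ⟨d, rfl⟩ := h
  intro x
  have hm : (m : ℝ) ≠ 0 := by rintro h; simp_all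
  have hd : (d : ℝ) ≠ 0 := by rintro h; simp_all
  rw [← hu.apply_add_div x d]
  congr 3
  push_cast
  field_simp

end Periodic

lemma sum_range_mul (n m : ℕ) (F : ℕ → ℝ) :
    ∑ c ∈ Finset.range (n * m), F c =
      ∑ a ∈ Finset.range m, ∑ b ∈ Finset.range n, F (n * a + b) := by
  induction m with
  | zero => simp
  | succ m ih => rw [Nat.mul_succ, Finset.sum_range_add, Finset.sum_range_succ, ih]

lemma sum_translates_add {β : Type*} [AddCommGroup β] {n : ℕ} (hn : n ≠ 0)
    (f : UnitAddCircle → β) (x : UnitAddCircle) :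
    ∑ k ∈ Finset.range n, f (x + ((1 / (n : ℝ) : ℝ) : UnitAddCircle) +
      (((k : ℝ) / (n : ℝ) : ℝ) : UnitAddCircle)) =
    ∑ k ∈ Finset.range n, f (x + (((k : ℝ) / (n : ℝ) : ℝ) : UnitAddCircle)) := by
  have hn' : (n : ℝ) ≠ 0 := by exact_mod_cast hn
  have key : ∀ k : ℕ, f (x + ((1 / (n : ℝ) : ℝ) : UnitAddCircle) +
      (((k : ℝ) / (n : ℝ) : ℝ) : UnitAddCircle)) =
      f (x + ((((k + 1 : ℕ) : ℝ) / (n : ℝ) : ℝ) : UnitAddCircle)) := by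
    intro k
    rw [add_assoc, ← AddCircle.coe_add]
    congr 3
    push_cast
    ring
  simp_rw [key]
  have h1 := Finset.sum_range_succ (fun k : ℕ => f (x + (((k : ℝ) / (n : ℝ) : ℝ) : UnitAddCircle)))
    n
  have h2 := Finset.sum_range_succ' (fun k : ℕ => f (x + (((k : ℝ) / (n : ℝ) : ℝ) : UnitAddCircle)))
    n
  have h3 : f (x + (((n : ℝ) / (n : ℝ) : ℝ) : UnitAddCircle)) =
      f (x + ((((0 : ℕ) : ℝ) / (n : ℝ) : ℝ) : UnitAddCircle)) := by
    rw [div_self hn', AddCircle.coe_period]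
    simp
  rw [h1, h3] at h2
  exact (add_right_cancel h2).symm

section Average

variable {n m : ℕ} {f g : UnitAddCircle → ℝ} {u : UnitAddCircle → ℝ}

lemma fracPeriodic_avg (hn : n ≠ 0) (f : UnitAddCircle → ℝ) : FracPeriodic n (avg n f) := by
  intro x
  rw [avg, sum_translates_add hn, avg]

lemma avg_mul_left (hu : FracPeriodic n u) (f : UnitAddCircle → ℝ) :
    avg n (fun x => u x * f x) = fun x => u x * avg n f x := by
  funext x
  simp only [avg, hu.apply_add_div, ← Finset.mul_sum]
  ring

lemma avg_add (f g : UnitAddCircle → ℝ) (x) :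
    avg n (fun x => f x + g x) x = avg n f x + avg n g x := by
  simp only [avg, Finset.sum_add_distrib]; ring

lemma avg_finset_sum {ι : Type*} (s : Finset ι) (f : ι → UnitAddCircle → ℝ) (x) :
    avg n (fun x => ∑ i ∈ s, f i x) x = ∑ i ∈ s, avg n (f i) x := by
  simp only [avg, Finset.mul_sum]
  exact Finset.sum_comm

lemma avg_const (hn : n ≠ 0) (c : ℝ) (x) : avg n (fun _ => c) x = c := by
  have hn' : (n : ℝ) ≠ 0 := by exact_mod_cast hn
  simp [avg]; field_simp

lemma avg_mono (h : ∀ x, f x ≤ g x) (x) : avg n f x ≤ avg n g x := by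
  unfold avg
  gcongr
  exact h _

lemma avg_nonneg (h : ∀ x, 0 ≤ f x) (x) : 0 ≤ avg n f x :=
  mul_nonneg (by positivity) (Finset.sum_nonneg fun _ _ => h _)

lemma avg_le (hn : n ≠ 0) {M : ℝ} (h : ∀ x, f x ≤ M) (x) : avg n f x ≤ M :=
  (avg_mono h x).trans (avg_const hn M x).le

@[fun_prop]
lemma measurable_avg (hf : Measurable f) : Measurable (avg n f) := by
  unfold avg; fun_prop

lemma integrable_avg (hf : Integrable f) : Integrable (avg n f) := by
  unfold avg
  exact (integrable_finsetSum _ fun k _ => hf.comp_add_right _).const_mul _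

lemma integral_avg (hn : n ≠ 0) (hf : Integrable f) : ∫ x, avg n f x = ∫ x, f x := by
  have hn' : (n : ℝ) ≠ 0 := by exact_mod_cast hn
  unfold avg
  rw [integral_const_mul, integral_finsetSum _ fun k _ => hf.comp_add_right _]
  simp_rw [integral_add_right_eq_self]
  simp; field_simp

lemma integral_mul_avg (hn : n ≠ 0) (hu : FracPeriodic n u)
    (huf : Integrable fun x => u x * f x) :
    ∫ x, u x * avg n f x = ∫ x, u x * f x := by
  rw [← integral_avg hn huf, avg_mul_left hu]

/-- Averaging does not change the integral over a set invariant under the translations. -/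
lemma setIntegral_avg (hn : n ≠ 0) {S : Set UnitAddCircle} (hS : MeasurableSet S)
    (hper : FracPeriodic n (· ∈ S)) (hf : Integrable f) :
    ∫ x in S, avg n f x = ∫ x in S, f x := by
  have hu : FracPeriodic n (S.indicator fun _ => (1 : ℝ)) := by
    intro x
    have := hper x
    simp only [eq_iff_iff] at this
    by_cases hx : x ∈ S
    · rw [Set.indicator_of_mem hx, Set.indicator_of_mem (this.2 hx)]
    · rw [Set.indicator_of_notMem hx, Set.indicator_of_notMem (mt this.1 hx)]
  have e : ∀ h : UnitAddCircle → ℝ, ∫ x in S, h x =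
      ∫ x, S.indicator (fun _ => (1 : ℝ)) x * h x := by
    intro h
    rw [← integral_indicator hS]
    congr 1; funext x
    by_cases hx : x ∈ S <;> simp [hx]
  rw [e, e]
  refine integral_mul_avg hn hu ?_
  refine (hf.indicator hS).congr (ae_of_all _ fun x => ?_)
  by_cases hx : x ∈ S <;> simp [hx]

/-- Averages over coprime moduli compose to the average over the product. -/
lemma avg_avg (hm : m ≠ 0) (hn : n ≠ 0) (hmn : n.Coprime m) (f : UnitAddCircle → ℝ) :
    avg n (avg m f) = avg (n * m) f := by
  funext x
  have hn' : (n : ℝ) ≠ 0 := by exact_mod_cast hn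
  have hm' : (m : ℝ) ≠ 0 := by exact_mod_cast hm
  set h := avg m f with hh
  have hper : FracPeriodic m h := fracPeriodic_avg hm f
  -- `H c` depends only on `c` modulo `n`
  set H : ℕ → ℝ := fun c => h (x + (((c : ℝ) / ((n : ℝ) * m) : ℝ) : UnitAddCircle)) with hH
  have hmod : ∀ c, H c = H (c % n) := by
    intro c
    have := hper.apply_add_div
      (x + ((((c % n : ℕ) : ℝ) / ((n : ℝ) * m) : ℝ) : UnitAddCircle)) (c / n)
    rw [add_assoc, ← AddCircle.coe_add] at this
    rw [hH]; dsimp only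
    rw [← this]
    congr 3
    have e : (c : ℝ) = (c % n : ℕ) + n * (c / n : ℕ) := by exact_mod_cast (Nat.mod_add_div c n).symm
    rw [e]; field_simp
  -- multiplication by `m` permutes the residues modulo `n`
  have h1 : ∑ b ∈ Finset.range n, H (b * m) = ∑ b ∈ Finset.range n, H b := by
    have hinj : Set.InjOn (fun b => b * m % n) (Finset.range n : Set ℕ) := by
      intro a ha b hb hab
      have : a ≡ b [MOD n] := Nat.ModEq.cancel_right_of_coprime hmn hab
      simp only [Finset.coe_range, Set.mem_Iio] at ha hb
      exact Nat.ModEq.eq_of_lt_of_lt this ha hb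
    have himg : (Finset.range n).image (fun b => b * m % n) = Finset.range n := by
      apply Finset.eq_of_subset_of_card_le
      · intro c hc
        obtain ⟨b, -, rfl⟩ := Finset.mem_image.1 hc
        exact Finset.mem_range.2 (Nat.mod_lt _ (Nat.pos_of_ne_zero hn))
      · rw [Finset.card_image_of_injOn hinj]
    conv_rhs => rw [← himg, Finset.sum_image hinj]
    exact Finset.sum_congr rfl fun b _ => hmod _
  have h2 : avg n h x = (1 / (n : ℝ)) * ∑ b ∈ Finset.range n, H (b * m) := by
    unfold avg
    congr 1
    refine Finset.sum_congr rfl fun b _ => ?_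
    simp only [hH]
    congr 3
    push_cast; field_simp
  rw [h2, h1]
  -- write `c = n * a + b`, so that `c / (n * m) = a / m + b / (n * m)`
  have h3 : ∑ c ∈ Finset.range (n * m),
      f (x + (((c : ℝ) / ((n * m : ℕ) : ℝ) : ℝ) : UnitAddCircle)) =
      ∑ b ∈ Finset.range n, ∑ a ∈ Finset.range m,
        f (x + (((b : ℝ) / ((n : ℝ) * m) : ℝ) : UnitAddCircle) +
          (((a : ℝ) / (m : ℝ) : ℝ) : UnitAddCircle)) := by
    rw [sum_range_mul, Finset.sum_comm]
    refine Finset.sum_congr rfl fun b _ => Finset.sum_congr rfl fun a _ => ?_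
    rw [add_assoc, ← AddCircle.coe_add]
    congr 3
    push_cast; field_simp; ring
  unfold avg
  rw [h3]
  simp only [hH, hh, avg, ← Finset.mul_sum]
  push_cast; field_simp

end Average

/-! ### Averages over products of primes -/

/-- The product of the primes whose indices, counted from `0`, lie in `S`. -/
def primeProd (S : Finset ℕ) : ℕ := ∏ i ∈ S, Nat.nth Nat.Prime i

lemma primeProd_ne_zero (S : Finset ℕ) : primeProd S ≠ 0 :=
  Finset.prod_ne_zero_iff.2 fun i _ => (Nat.prime_nth_prime i).ne_zero

lemma primeProd_dvd {S T : Finset ℕ} (h : S ⊆ T) : primeProd S ∣ primeProd T :=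
  Finset.prod_dvd_prod_of_subset _ _ _ h

lemma primeProd_coprime {S T : Finset ℕ} (h : Disjoint S T) :
    (primeProd S).Coprime (primeProd T) := by
  refine Nat.Coprime.prod_left fun i hi => Nat.Coprime.prod_right fun j hj => ?_
  rw [Nat.coprime_primes (Nat.prime_nth_prime i) (Nat.prime_nth_prime j)]
  intro hij
  have := Nat.nth_injective Nat.infinite_setOfPred_prime hij
  exact (Finset.disjoint_left.1 h hi) (this ▸ hj)

/-- The average over the translates by multiples of `1 / primeProd S`. It acts like the
integration over the coordinates in `S` of a product space. -/
abbrev primeAvg (S : Finset ℕ) (f : UnitAddCircle → ℝ) : UnitAddCircle → ℝ :=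
  avg (primeProd S) f

lemma primeAvg_union {S T : Finset ℕ} (h : Disjoint S T) (f : UnitAddCircle → ℝ) :
    primeAvg (S ∪ T) f = primeAvg S (primeAvg T f) := by
  rw [primeAvg, primeAvg, primeAvg, avg_avg (primeProd_ne_zero _) (primeProd_ne_zero _)
    (primeProd_coprime h), primeProd, Finset.prod_union h]
  rfl

lemma fracPeriodic_primeAvg {S T : Finset ℕ} (h : S ⊆ T) (f : UnitAddCircle → ℝ) :
    FracPeriodic (primeProd S) (primeAvg T f) :=
  (fracPeriodic_avg (primeProd_ne_zero T) f).of_dvd (primeProd_ne_zero T) (primeProd_dvd h)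

lemma primeAvg_empty (f : UnitAddCircle → ℝ) : primeAvg ∅ f = f := by
  funext x; simp [primeAvg, avg, primeProd]

lemma primeAvg_range_succ (f : UnitAddCircle → ℝ) (j : ℕ) :
    primeAvg (Finset.range (j + 1)) f = primeAvg {j} (primeAvg (Finset.range j) f) := by
  rw [← primeAvg_union (by simp), Finset.range_add_one]
  rfl

lemma primeAvg_range_eq (f : UnitAddCircle → ℝ) {j k : ℕ} (h : j < k) :
    primeAvg (Finset.range k) f =
      primeAvg (Finset.Ioo j k) (primeAvg (Finset.range (j + 1)) f) := by
  rw [← primeAvg_union]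
  · congr 1; ext i; simp; omega
  · rw [Finset.disjoint_left]; intro i; simp; omega

lemma primeAvg_erase_eq (f : UnitAddCircle → ℝ) {j k : ℕ} (h : j < k) :
    primeAvg ((Finset.range k).erase j) f =
      primeAvg (Finset.Ioo j k) (primeAvg (Finset.range j) f) := by
  rw [← primeAvg_union]
  · congr 1; ext i; simp; omega
  · rw [Finset.disjoint_left]; intro i; simp; omega

/-! ### The last index at which a sequence of sets is hit -/

section LastHit

/-- The points for which `k` is the largest index up to `N` whose set `H k` contains them. Since
the averages form a reverse martingale, this is the first hit in the order of the martingale. The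
condition `k ≤ N` is left to the places of use. -/
def lastHit {α : Type*} (H : ℕ → Set α) (N k : ℕ) : Set α :=
  {x | x ∈ H k ∧ ∀ l, k < l → l ≤ N → x ∉ H l}

variable {α : Type*} {H : ℕ → Set α} {N : ℕ}

lemma lastHit_disjoint {k l : ℕ} (hl : l ≤ N) (hk : k ≤ N) (hkl : k ≠ l) :
    Disjoint (lastHit H N k) (lastHit H N l) := by
  rw [Set.disjoint_left]
  rintro x ⟨h1, h2⟩ ⟨h3, h4⟩
  rcases lt_or_gt_of_ne hkl with h | h
  · exact h2 l h hl h3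
  · exact h4 k h hk h1

lemma exists_mem_lastHit {x : α} {k : ℕ} (hk : k ≤ N) (hx : x ∈ H k) :
    ∃ l, k ≤ l ∧ l ≤ N ∧ x ∈ lastHit H N l := by
  classical
  have hne : ((Finset.range (N + 1)).filter fun l => x ∈ H l).Nonempty :=
    ⟨k, by simp; exact ⟨by omega, hx⟩⟩
  have hmem := Finset.max'_mem _ hne
  set l := Finset.max' _ hne with hl
  simp only [Finset.mem_filter, Finset.mem_range] at hmem
  refine ⟨l, Finset.le_max' _ _ (by simp; exact ⟨by omega, hx⟩), by omega, hmem.2, ?_⟩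
  intro l' h1 h2 h3
  have : l' ≤ l := Finset.le_max' _ _ (by simp; exact ⟨by omega, h3⟩)
  omega

lemma measurableSet_lastHit [MeasurableSpace α] (hH : ∀ k, MeasurableSet (H k)) (k : ℕ) :
    MeasurableSet (lastHit H N k) := by
  have : lastHit H N k = H k ∩ ⋂ l, ⋂ (_ : k < l), ⋂ (_ : l ≤ N), (H l)ᶜ := by
    ext x; simp [lastHit]
  rw [this]
  exact (hH k).inter (.iInter fun l => .iInter fun _ => .iInter fun _ => (hH l).compl)

/-- The set where `k` is the last hit depends only on the sets of index at least `k`. -/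
lemma fracPeriodic_lastHit {H : ℕ → Set UnitAddCircle} {n k : ℕ}
    (hH : ∀ l, k ≤ l → l ≤ N → FracPeriodic n (· ∈ H l)) (hk : k ≤ N) :
    FracPeriodic n (· ∈ lastHit H N k) := by
  intro x
  have h : ∀ l, k ≤ l → l ≤ N → (x + ((1 / (n : ℝ) : ℝ) : UnitAddCircle) ∈ H l ↔ x ∈ H l) :=
    fun l h1 h2 => by simpa using hH l h1 h2 x
  simp only [lastHit, Set.mem_ofPred_eq, eq_iff_iff, h k le_rfl hk]
  refine and_congr_right fun _ => ?_
  exact forall_congr' fun l => forall_congr' fun h1 => forall_congr' fun h2 =>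
    not_congr (h l h1.le h2)

lemma sum_setIntegral_le [MeasurableSpace α] {μ : Measure α} {f : α → ℝ} (hf : Integrable f μ)
    (h0 : ∀ x, 0 ≤ f x) (s : Finset ℕ) {S : ℕ → Set α} (hS : ∀ k ∈ s, MeasurableSet (S k))
    (hd : Set.PairwiseDisjoint (s : Set ℕ) S) :
    ∑ k ∈ s, ∫ x in S k, f x ∂μ ≤ ∫ x, f x ∂μ := by
  rw [← integral_biUnion_finset s hS hd fun k _ => hf.integrableOn]
  exact setIntegral_le_integral hf (ae_of_all _ h0)

end LastHit

/-! ### Weak type bound for the averages over initial products -/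

/-- The maximal inequality for the reverse martingale of the averages over the first `k` primes. -/
theorem weak_type_primeAvg_range {f : UnitAddCircle → ℝ} (hfm : Measurable f) (hf : Integrable f)
    (h0 : ∀ x, 0 ≤ f x) {ε : ℝ} (hε : 0 < ε) (N : ℕ) :
    volume.real {x | ∃ k ≤ N, ε < primeAvg (Finset.range k) f x} ≤ (∫ x, f x) / ε := by
  set H : ℕ → Set UnitAddCircle := fun k => {x | ε < primeAvg (Finset.range k) f x} with hH
  have hHm : ∀ k, MeasurableSet (H k) := fun k =>
    measurableSet_lt measurable_const (measurable_avg hfm)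
  have hSm := measurableSet_lastHit (N := N) hHm
  have hsub : {x | ∃ k ≤ N, ε < primeAvg (Finset.range k) f x} ⊆
      ⋃ k ∈ Finset.range (N + 1), lastHit H N k := by
    rintro x ⟨k, hk, hx⟩
    obtain ⟨l, -, hl, hxl⟩ := exists_mem_lastHit (H := H) hk hx
    exact Set.mem_biUnion (by simpa using Nat.lt_succ_of_le hl) hxl
  rw [le_div_iff₀ hε]
  calc volume.real {x | ∃ k ≤ N, ε < primeAvg (Finset.range k) f x} * ε
      ≤ (∑ k ∈ Finset.range (N + 1), volume.real (lastHit H N k)) * ε := by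
        gcongr
        exact (measureReal_mono hsub (measure_ne_top _ _)).trans (measureReal_biUnion_finset_le _ _)
    _ = ∑ k ∈ Finset.range (N + 1), ∫ x in lastHit H N k, ε := by
        simp [Finset.sum_mul]
    _ ≤ ∑ k ∈ Finset.range (N + 1), ∫ x in lastHit H N k, primeAvg (Finset.range k) f x := by
        refine Finset.sum_le_sum fun k _ => ?_
        refine setIntegral_mono_on (by simp) (integrable_avg hf).integrableOn (hSm k) ?_
        exact fun x hx => hx.1.le
    _ = ∑ k ∈ Finset.range (N + 1), ∫ x in lastHit H N k, f x := by
        refine Finset.sum_congr rfl fun k hk => ?_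
        refine setIntegral_avg (primeProd_ne_zero _) (hSm k) (fracPeriodic_lastHit ?_ ?_) hf
        · intro l hl _ x
          have := fracPeriodic_primeAvg (Finset.range_subset_range.2 hl) f x
          simp only [hH, Set.mem_ofPred_eq, this]
        · simpa using Nat.lt_succ_iff.1 (Finset.mem_range.1 hk)
    _ ≤ ∫ x, f x := by
        refine sum_setIntegral_le hf h0 _ (fun k _ => hSm k) ?_
        intro k hk l hl hkl
        simp only [Finset.coe_range, Set.mem_Iio] at hk hl
        exact lastHit_disjoint (by omega) (by omega) hkl

/-! ### The entropy estimate -/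

section Entropy

/-- The density of the relative entropy of `a` with respect to `b`, both shifted by `ε`:
`(a + ε) log ((a + ε) / (b + ε)) - (a - b)`. It is the Bregman divergence of
`y ↦ (y + ε) log (y + ε)`. -/
def relEnt (ε a b : ℝ) : ℝ := (a + ε) * Real.log ((a + ε) / (b + ε)) - (a - b)

/-- Young's inequality: the relative entropy lies above its affine minorants, one for each slope
`s`. Being affine in `(a, b)`, they commute with averages. -/
lemma relEnt_ge {ε a b : ℝ} (hε : 0 < ε) (ha : 0 ≤ a) (hb : 0 ≤ b) (s : ℝ) :
    s * (a + ε) - (b + ε) * (Real.exp s - 1) ≤ relEnt ε a b := by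
  have ha' : 0 < a + ε := by linarith
  have hb' : 0 < b + ε := by linarith
  have h1 := Real.add_one_le_exp (s - Real.log ((a + ε) / (b + ε)))
  rw [Real.exp_sub, Real.exp_log (by positivity)] at h1
  have h2 : (a + ε) * (s - Real.log ((a + ε) / (b + ε)) + 1) ≤ Real.exp s * (b + ε) := by
    calc _ ≤ (a + ε) * (Real.exp s / ((a + ε) / (b + ε))) := by gcongr
      _ = _ := by field_simp
  unfold relEnt
  linarith

lemma relEnt_nonneg {ε a b : ℝ} (hε : 0 < ε) (ha : 0 ≤ a) (hb : 0 ≤ b) : 0 ≤ relEnt ε a b := by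
  simpa using relEnt_ge hε ha hb 0

lemma integrable_of_measurable_of_le {f : UnitAddCircle → ℝ} (hfm : Measurable f)
    (h0 : ∀ x, 0 ≤ f x) {M : ℝ} (hM : ∀ x, f x ≤ M) : Integrable f :=
  .of_bound hfm.aestronglyMeasurable M (ae_of_all _ fun x => by
    rw [Real.norm_of_nonneg (h0 x)]; exact hM x)

lemma integrable_mul_log {f g : UnitAddCircle → ℝ} (hf : Integrable f) (hgm : Measurable g)
    (hg0 : ∀ x, 0 ≤ g x) {M ε : ℝ} (hε : 0 < ε) (hM : ∀ x, g x ≤ M) :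
    Integrable fun x => (f x + ε) * Real.log (g x + ε) := by
  refine (hf.add (integrable_const ε)).mul_bdd (c := |Real.log ε| + |Real.log (M + ε)|) ?_ ?_
  · exact (Real.measurable_log.comp (hgm.add_const ε)).aestronglyMeasurable
  · refine ae_of_all _ fun x => ?_
    have h1 : Real.log ε ≤ Real.log (g x + ε) := Real.log_le_log hε (by linarith [hg0 x])
    have h2 : Real.log (g x + ε) ≤ Real.log (M + ε) :=
      Real.log_le_log (by linarith [hg0 x]) (by linarith [hM x])
    rw [Real.norm_eq_abs, abs_le]
    have := neg_abs_le (Real.log ε)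
    have := le_abs_self (Real.log (M + ε))
    have := abs_nonneg (Real.log ε)
    have := abs_nonneg (Real.log (M + ε))
    constructor <;> linarith

variable {f : UnitAddCircle → ℝ} {M ε : ℝ}

lemma relEnt_eq {a b : ℝ} (hε : 0 < ε) (ha : 0 ≤ a) (hb : 0 ≤ b) :
    relEnt ε a b = (a + ε) * Real.log (a + ε) - (a + ε) * Real.log (b + ε) - (a - b) := by
  rw [relEnt, Real.log_div (by linarith) (by linarith)]
  ring

lemma integrable_relEnt {g : UnitAddCircle → ℝ} (hfm : Measurable f) (h0 : ∀ x, 0 ≤ f x)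
    (hM : ∀ x, f x ≤ M) (hgm : Measurable g) (hg0 : ∀ x, 0 ≤ g x) (hgM : ∀ x, g x ≤ M)
    (hε : 0 < ε) : Integrable fun x => relEnt ε (f x) (g x) := by
  have hf := integrable_of_measurable_of_le hfm h0 hM
  have hg := integrable_of_measurable_of_le hgm hg0 hgM
  simp only [relEnt_eq hε (h0 _) (hg0 _)]
  exact ((integrable_mul_log hf hfm h0 hε hM).sub (integrable_mul_log hf hgm hg0 hε hgM)).sub
    (hf.sub hg)

/-- The chain rule: the relative entropy of `f` with respect to its average is the loss of entropy
in averaging, because the average is constant along the translations. -/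
lemma integral_relEnt_avg (hfm : Measurable f) (h0 : ∀ x, 0 ≤ f x) (hM : ∀ x, f x ≤ M)
    (hε : 0 < ε) {n : ℕ} (hn : n ≠ 0) :
    ∫ x, relEnt ε (f x) (avg n f x) =
      (∫ x, (f x + ε) * Real.log (f x + ε)) -
        ∫ x, (avg n f x + ε) * Real.log (avg n f x + ε) := by
  have hf := integrable_of_measurable_of_le hfm h0 hM
  have hgm : Measurable (avg n f) := measurable_avg hfm
  have hg0 := avg_nonneg (n := n) h0
  have hgM := avg_le hn hM
  have hg := integrable_avg (n := n) hf
  have i1 := integrable_mul_log hf hfm h0 hε hM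
  have i2 := integrable_mul_log hf hgm hg0 hε hgM
  simp only [relEnt_eq hε (h0 _) (hg0 _)]
  have i12 : Integrable fun x => (f x + ε) * Real.log (f x + ε) -
      (f x + ε) * Real.log (avg n f x + ε) := i1.sub i2
  have i3 : Integrable fun x => f x - avg n f x := hf.sub hg
  rw [integral_sub i12 i3, integral_sub i1 i2, integral_sub hf hg,
    integral_avg hn hf, sub_self, sub_zero]
  congr 1
  have hu : FracPeriodic n fun x => Real.log (avg n f x + ε) := fun x => by
    simp only [fracPeriodic_avg hn f x]
  have := integral_mul_avg (f := fun x => f x + ε) hn hu (by simpa only [mul_comm] using i2)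
  simp only [avg_add, avg_const hn] at this
  simp only [mul_comm (_ + ε)]
  exact this.symm

/-- The telescoped entropy. The bound is linear in `∫ f`, without a term `∫ f * log (1 / ∫ f)`,
thanks to the shift by `ε`. -/
lemma sum_integral_relEnt_le (hfm : Measurable f) (h0 : ∀ x, 0 ≤ f x) (hM : ∀ x, f x ≤ M)
    (hε : 0 < ε) (N : ℕ) :
    ∑ j ∈ Finset.range N, ∫ x, relEnt ε (primeAvg (Finset.range j) f x)
      (primeAvg (Finset.range (j + 1)) f x) ≤ (∫ x, f x) * Real.log (1 + M / ε) := by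
  have hf := integrable_of_measurable_of_le hfm h0 hM
  set L : ℕ → ℝ := fun j => ∫ x, (primeAvg (Finset.range j) f x + ε) *
    Real.log (primeAvg (Finset.range j) f x + ε) with hL
  have hstep : ∀ j, ∫ x, relEnt ε (primeAvg (Finset.range j) f x)
      (primeAvg (Finset.range (j + 1)) f x) = L j - L (j + 1) := by
    intro j
    simp only [hL, primeAvg_range_succ]
    exact integral_relEnt_avg (measurable_avg hfm) (avg_nonneg h0)
      (avg_le (primeProd_ne_zero _) hM) hε (primeProd_ne_zero _)
  simp only [hstep]
  rw [Finset.sum_range_sub']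
  set g := primeAvg (Finset.range N) f with hg
  have hgm : Measurable g := measurable_avg hfm
  have hg0 : ∀ x, 0 ≤ g x := avg_nonneg h0
  have hgM : ∀ x, g x ≤ M := avg_le (primeProd_ne_zero _) hM
  have hgi : Integrable g := integrable_avg hf
  have hgint : ∫ x, g x = ∫ x, f x := integral_avg (primeProd_ne_zero _) hf
  -- the tangent line of `y ↦ (y + ε) log (y + ε)` at `y = 0` bounds the last term from below
  have hlow : ∫ x, ((g x + ε) * Real.log ε + g x) ≤ L N := by
    refine integral_mono (((hgi.add (integrable_const ε)).mul_const _).add hgi)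
      (integrable_mul_log hgi hgm hg0 hε hgM) fun x => ?_
    have h1 : 0 < g x + ε := by linarith [hg0 x]
    have h2 := relEnt_nonneg hε (hg0 x) le_rfl
    rw [relEnt_eq hε (hg0 x) le_rfl] at h2
    simp only [zero_add, sub_zero] at h2
    dsimp only
    linarith
  have hup : L 0 ≤ ∫ x, ((f x + ε) * Real.log ε + f x + f x * Real.log (1 + M / ε)) := by
    simp only [hL, Finset.range_zero, primeAvg_empty]
    refine integral_mono (integrable_mul_log hf hfm h0 hε hM)
      ((((hf.add (integrable_const ε)).mul_const _).add hf).add (hf.mul_const _)) fun x => ?_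
    have h1 : 0 < f x + ε := by linarith [h0 x]
    have h2 : 0 < 1 + f x / ε := by have := h0 x; positivity
    have e : f x + ε = ε * (1 + f x / ε) := by field_simp; ring
    have h3 : Real.log (f x + ε) = Real.log ε + Real.log (1 + f x / ε) := by
      rw [← Real.log_mul hε.ne' h2.ne', ← e]
    have h4 : ε * Real.log (1 + f x / ε) ≤ f x := by
      calc _ ≤ ε * (1 + f x / ε - 1) := by gcongr; exact Real.log_le_sub_one_of_pos h2
        _ = f x := by field_simp; ring
    have h5 : f x * Real.log (1 + f x / ε) ≤ f x * Real.log (1 + M / ε) := by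
      gcongr
      · exact h0 x
      · exact hM x
    dsimp only
    rw [h3]
    linarith
  have e1 : ∫ x, ((g x + ε) * Real.log ε + g x) = ((∫ x, f x) + ε) * Real.log ε + ∫ x, f x := by
    have i1 : Integrable fun x => (g x + ε) * Real.log ε :=
      (hgi.add (integrable_const ε)).mul_const _
    rw [integral_add i1 hgi, integral_mul_const, integral_add hgi (integrable_const ε), hgint]
    simp [measureReal_def]
  have e2 : ∫ x, ((f x + ε) * Real.log ε + f x + f x * Real.log (1 + M / ε)) =
      ((∫ x, f x) + ε) * Real.log ε + (∫ x, f x) + (∫ x, f x) * Real.log (1 + M / ε) := by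
    have i1 : Integrable fun x => (f x + ε) * Real.log ε :=
      (hf.add (integrable_const ε)).mul_const _
    have i2 : Integrable fun x => (f x + ε) * Real.log ε + f x := i1.add hf
    rw [integral_add i2 (hf.mul_const _), integral_add i1 hf, integral_mul_const,
      integral_mul_const, integral_add hf (integrable_const ε)]
    simp [measureReal_def]
  linarith

/-- The mass that the averages omitting one prime carry above the height `lam`, at points where the
full average is at most `ε`, is controlled by the entropy of `f`, with a gain of the factor
`s ≤ log (lam / ε)`. The sets `S j k` are pieces of stopping sets, disjoint in `k`. -/
theorem sum_setIntegral_primeAvg_erase_le (hfm : Measurable f) (h0 : ∀ x, 0 ≤ f x)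
    (hM : ∀ x, f x ≤ M) (hε : 0 < ε) {s lam : ℝ} (hs : 4 ≤ s) (hlam : ε * Real.exp s ≤ lam)
    (N : ℕ) {S : ℕ → ℕ → Set UnitAddCircle} (hSm : ∀ j k, MeasurableSet (S j k))
    (hper : ∀ j k, j < k → k ≤ N → FracPeriodic (primeProd (Finset.Ioo j k)) (· ∈ S j k))
    (hsub : ∀ j k, j < k → k ≤ N → ∀ x ∈ S j k,
      lam < primeAvg ((Finset.range k).erase j) f x ∧ primeAvg (Finset.range k) f x ≤ ε)
    (hdisj : ∀ j, Set.PairwiseDisjoint (Finset.Ioc j N : Set ℕ) (S j)) :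
    ∑ j ∈ Finset.range N, ∑ k ∈ Finset.Ioc j N,
        ∫ x in S j k, primeAvg ((Finset.range k).erase j) f x ≤
      2 / s * ((∫ x, f x) * Real.log (1 + M / ε)) := by
  have hf := integrable_of_measurable_of_le hfm h0 hM
  have hmain : ∀ j ∈ Finset.range N, s / 2 * ∑ k ∈ Finset.Ioc j N,
      ∫ x in S j k, primeAvg ((Finset.range k).erase j) f x ≤
      ∫ x, relEnt ε (primeAvg (Finset.range j) f x) (primeAvg (Finset.range (j + 1)) f x) := by
    intro j _
    set a := primeAvg (Finset.range j) f
    set b := primeAvg (Finset.range (j + 1)) f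
    have ha : Integrable a := integrable_avg hf
    have hb : Integrable b := integrable_avg hf
    have ha0 : ∀ x, 0 ≤ a x := avg_nonneg h0
    have hb0 : ∀ x, 0 ≤ b x := avg_nonneg h0
    have hB : Integrable fun x => relEnt ε (a x) (b x) :=
      integrable_relEnt (measurable_avg hfm) ha0 (avg_le (primeProd_ne_zero _) hM)
        (measurable_avg hfm) hb0 (avg_le (primeProd_ne_zero _) hM) hε
    refine le_trans ?_ (sum_setIntegral_le hB (fun x => relEnt_nonneg hε (ha0 x) (hb0 x))
      (Finset.Ioc j N) (fun k _ => hSm j k) (hdisj j))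
    rw [Finset.mul_sum]
    refine Finset.sum_le_sum fun k hk => ?_
    obtain ⟨hjk, hkN⟩ := Finset.mem_Ioc.1 hk
    have hn := primeProd_ne_zero (Finset.Ioo j k)
    have hP := hper j k hjk hkN
    have hm := hSm j k
    have iA := integrable_avg (n := primeProd (Finset.Ioo j k)) ha
    have iG := integrable_avg (n := primeProd (Finset.Ioo j k)) hb
    have key : ∀ u v : UnitAddCircle → ℝ, Integrable u → Integrable v →
        ∫ x in S j k, (s * u x - (v x + ε) * Real.exp s) =
        s * (∫ x in S j k, u x) - ((∫ x in S j k, v x) + ∫ x in S j k, ε) * Real.exp s := by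
      intro u v hu hv
      have i1 : Integrable (fun x => (v x + ε) * Real.exp s) (volume.restrict (S j k)) :=
        (hv.integrableOn.add (integrable_const ε)).mul_const _
      rw [integral_sub (hu.integrableOn.const_mul s) i1, integral_const_mul,
        integral_mul_const, integral_add hv.integrableOn (integrable_const ε)]
    -- both sides are affine in the averaged functions, so averaging can be undone on `S j k`
    have hswap : ∫ x in S j k, (s * primeAvg (Finset.Ioo j k) a x -
        (primeAvg (Finset.Ioo j k) b x + ε) * Real.exp s) =
        ∫ x in S j k, (s * a x - (b x + ε) * Real.exp s) := by
      rw [key _ _ iA iG, key _ _ ha hb, setIntegral_avg hn hm hP ha, setIntegral_avg hn hm hP hb]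
    calc s / 2 * ∫ x in S j k, primeAvg ((Finset.range k).erase j) f x
        = ∫ x in S j k, s / 2 * primeAvg (Finset.Ioo j k) a x := by
          rw [integral_const_mul, primeAvg_erase_eq f hjk]
      _ ≤ ∫ x in S j k, (s * primeAvg (Finset.Ioo j k) a x -
            (primeAvg (Finset.Ioo j k) b x + ε) * Real.exp s) := by
          refine setIntegral_mono_on (iA.integrableOn.const_mul _)
            ((iA.integrableOn.const_mul s).sub
              ((iG.integrableOn.add (integrable_const ε)).mul_const _)) hm fun x hx => ?_
          obtain ⟨h1, h2⟩ := hsub j k hjk hkN x hx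
          rw [primeAvg_erase_eq f hjk] at h1
          rw [primeAvg_range_eq f hjk] at h2
          have h3 : (primeAvg (Finset.Ioo j k) b x + ε) * Real.exp s ≤ 2 * lam := by
            calc _ ≤ (ε + ε) * Real.exp s := by gcongr
              _ ≤ 2 * lam := by linarith
          have hlam0 : 0 < lam := lt_of_lt_of_le (by positivity) hlam
          have h4 : 4 * lam ≤ s * primeAvg (Finset.Ioo j k) a x := by gcongr
          linarith
      _ = ∫ x in S j k, (s * a x - (b x + ε) * Real.exp s) := hswap
      _ ≤ ∫ x in S j k, relEnt ε (a x) (b x) := by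
          refine setIntegral_mono_on ((ha.integrableOn.const_mul s).sub
              ((hb.integrableOn.add (integrable_const ε)).mul_const _)) hB.integrableOn hm
            fun x _ => ?_
          have h1 := relEnt_ge hε (ha0 x) (hb0 x) s
          have h2 : 0 ≤ s * ε := by positivity
          have h3 := hb0 x
          linarith
  have hsum : s / 2 * ∑ j ∈ Finset.range N, ∑ k ∈ Finset.Ioc j N,
      ∫ x in S j k, primeAvg ((Finset.range k).erase j) f x ≤
      (∫ x, f x) * Real.log (1 + M / ε) := by
    rw [Finset.mul_sum]
    exact (Finset.sum_le_sum hmain).trans (sum_integral_relEnt_le hfm h0 hM hε N)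
  calc _ = 2 / s * (s / 2 * ∑ j ∈ Finset.range N, ∑ k ∈ Finset.Ioc j N,
      ∫ x in S j k, primeAvg ((Finset.range k).erase j) f x) := by field_simp
    _ ≤ _ := by gcongr

end Entropy

/-! ### Maximal inequality for finitely many bounded functions -/

section Levels

variable {I : Finset ℕ} {f : ℕ → UnitAddCircle → ℝ} {M ε s lam : ℕ → ℝ}

/-- A weak type inequality for a sum of functions, additive in the summands: thresholds `lam i` of
total `1 / 2` are discarded, and the rest is measured in `L¹`, so that no factor `1 / lam i`
appears. -/
theorem measure_exists_sum_primeAvg_erase_le (hfm : ∀ i, Measurable (f i))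
    (h0 : ∀ i x, 0 ≤ f i x) (hM : ∀ i x, f i x ≤ M i) (hε : ∀ i ∈ I, 0 < ε i)
    (hs : ∀ i ∈ I, 4 ≤ s i) (hlam : ∀ i ∈ I, ε i * Real.exp (s i) ≤ lam i)
    (hsum : ∑ i ∈ I, lam i ≤ 1 / 2) (N : ℕ) :
    volume.real {x | ∃ k ≤ N, ∃ j < k,
      1 < ∑ i ∈ I, primeAvg ((Finset.range k).erase j) (f i) x} ≤
      ∑ i ∈ I, (1 / ε i + 4 / s i * Real.log (1 + M i / ε i)) * ∫ x, f i x := by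
  have hf : ∀ i, Integrable (f i) := fun i =>
    integrable_of_measurable_of_le (hfm i) (h0 i) (hM i)
  set A : ℕ → ℕ → ℕ → UnitAddCircle → ℝ := fun i j k => primeAvg ((Finset.range k).erase j) (f i)
    with hA
  have hAm : ∀ i j k, Measurable (A i j k) := fun i j k => measurable_avg (hfm i)
  have hAi : ∀ i j k, Integrable (A i j k) := fun i j k => integrable_avg (hf i)
  have hA0 : ∀ i j k x, 0 ≤ A i j k x := fun i j k => avg_nonneg (h0 i)
  set G : ℕ → ℕ → UnitAddCircle → ℝ := fun i k => primeAvg (Finset.range k) (f i) with hG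
  have hGm : ∀ i k, Measurable (G i k) := fun i k => measurable_avg (hfm i)
  set H : ℕ → ℕ → Set UnitAddCircle := fun j k =>
    {x | 1 < ∑ i ∈ I, A i j k x} ∩ ⋂ i ∈ I, {x | G i k x ≤ ε i} with hH
  have hHm : ∀ j k, MeasurableSet (H j k) := fun j k =>
    (measurableSet_lt measurable_const (Finset.measurable_sum _ fun i _ => hAm i j k)).inter
      (Finset.measurableSet_biInter _ fun i _ => measurableSet_le (hGm i k) measurable_const)
  set W : ℕ → ℕ → Set UnitAddCircle := fun j k => lastHit (H j) N k with hW
  have hWm : ∀ j k, MeasurableSet (W j k) := fun j k => measurableSet_lastHit (hHm j) k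
  have hWdisj : ∀ j, Set.PairwiseDisjoint (Finset.Ioc j N : Set ℕ) (W j) := by
    intro j k hk l hl hkl
    simp only [Finset.coe_Ioc, Set.mem_Ioc] at hk hl
    exact lastHit_disjoint hl.2 hk.2 hkl
  -- the stopping index is common to all the functions, the threshold depends on the function
  set S : ℕ → ℕ → ℕ → Set UnitAddCircle := fun i j k => W j k ∩ {x | lam i < A i j k x} with hS
  have hBm : ∀ i j k, MeasurableSet {x | lam i < A i j k x} := fun i j k =>
    measurableSet_lt measurable_const (hAm i j k)
  have hSm : ∀ i j k, MeasurableSet (S i j k) := fun i j k => (hWm j k).inter (hBm i j k)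
  have hApp : ∀ i j k l, k ≤ l → FracPeriodic (primeProd (Finset.Ioo j k)) (A i j l) := by
    intro i j k l hl
    refine fracPeriodic_primeAvg (fun a => ?_) _
    simp; omega
  have hGpp : ∀ i j k l, k ≤ l → FracPeriodic (primeProd (Finset.Ioo j k)) (G i l) := by
    intro i j k l hl
    refine fracPeriodic_primeAvg (fun a => ?_) _
    simp; omega
  have hSper : ∀ i j k, j < k → k ≤ N →
      FracPeriodic (primeProd (Finset.Ioo j k)) (· ∈ S i j k) := by
    intro i j k _ hkN x
    have h1 : (_ ∈ W j k) = (x ∈ W j k) := fracPeriodic_lastHit (H := H j)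
      (n := primeProd (Finset.Ioo j k)) (fun l hl _ x => by
        have h2 := fun i => hApp i j k l hl x
        have h3 := fun i => hGpp i j k l hl x
        simp only [hH, Set.mem_inter_iff, Set.mem_ofPred_eq, Set.mem_iInter, h2, h3]) hkN x
    have h2 := hApp i j k k le_rfl x
    simp only [hS, Set.mem_inter_iff, Set.mem_ofPred_eq, h1, h2]
  -- at a hit the sum exceeds `1`, of which terms below their thresholds make up at most `1 / 2`
  have hWle : ∀ j k, volume.real (W j k) ≤ 2 * ∑ i ∈ I, ∫ x in S i j k, A i j k x := by
    intro j k
    have hInd : ∀ i, IntegrableOn ({x | lam i < A i j k x}.indicator (A i j k)) (W j k) :=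
      fun i => ((hAi i j k).indicator (hBm i j k)).integrableOn
    calc volume.real (W j k) = ∫ x in W j k, (1 : ℝ) := by simp
      _ ≤ ∫ x in W j k, 2 * ∑ i ∈ I, {x | lam i < A i j k x}.indicator (A i j k) x := by
          refine setIntegral_mono_on (integrable_const _)
            ((integrable_finsetSum _ fun i _ => hInd i).const_mul 2) (hWm j k) fun x hx => ?_
          have h1 : 1 < ∑ i ∈ I, A i j k x := hx.1.1
          have h2 : ∑ i ∈ I, A i j k x ≤
              ∑ i ∈ I, (lam i + {x | lam i < A i j k x}.indicator (A i j k) x) := by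
            refine Finset.sum_le_sum fun i hi => ?_
            by_cases h : lam i < A i j k x
            · rw [Set.indicator_of_mem (by exact h)]
              have : 0 < lam i := lt_of_lt_of_le (mul_pos (hε i hi) (Real.exp_pos _)) (hlam i hi)
              linarith
            · rw [Set.indicator_of_notMem (by exact h)]
              linarith
          rw [Finset.sum_add_distrib] at h2
          linarith
      _ = 2 * ∑ i ∈ I, ∫ x in S i j k, A i j k x := by
          rw [integral_const_mul, integral_finsetSum _ fun i _ => hInd i]
          congr 1
          refine Finset.sum_congr rfl fun i _ => ?_
          rw [setIntegral_indicator (hBm i j k)]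
  -- outside the hitting sets, some full average exceeds its threshold
  have hcover : {x | ∃ k ≤ N, ∃ j < k, 1 < ∑ i ∈ I, A i j k x} ⊆
      (⋃ i ∈ I, {x | ∃ k ≤ N, ε i < G i k x}) ∪
        ⋃ j ∈ Finset.range N, ⋃ k ∈ Finset.Ioc j N, W j k := by
    rintro x ⟨k, hk, j, hj, hx⟩
    by_cases hU : ∃ i ∈ I, ε i < G i k x
    · obtain ⟨i, hi, h⟩ := hU
      exact Or.inl (Set.mem_biUnion hi ⟨k, hk, h⟩)
    · push Not at hU
      have hxH : x ∈ H j k := ⟨hx, by simpa using hU⟩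
      obtain ⟨l, hkl, hlN, hl⟩ := exists_mem_lastHit (H := H j) hk hxH
      refine Or.inr (Set.mem_biUnion (x := j) (by simp; omega) (Set.mem_biUnion (x := l) ?_ hl))
      simp; omega
  calc _ ≤ volume.real (⋃ i ∈ I, {x | ∃ k ≤ N, ε i < G i k x}) +
        volume.real (⋃ j ∈ Finset.range N, ⋃ k ∈ Finset.Ioc j N, W j k) :=
        (measureReal_mono hcover (measure_ne_top _ _)).trans (measureReal_union_le _ _)
    _ ≤ (∑ i ∈ I, (∫ x, f i x) / ε i) +
        ∑ j ∈ Finset.range N, ∑ k ∈ Finset.Ioc j N, 2 * ∑ i ∈ I, ∫ x in S i j k, A i j k x := by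
        refine add_le_add ((measureReal_biUnion_finset_le _ _).trans
          (Finset.sum_le_sum fun i hi => ?_)) ((measureReal_biUnion_finset_le _ _).trans
          (Finset.sum_le_sum fun j _ => (measureReal_biUnion_finset_le _ _).trans
          (Finset.sum_le_sum fun k _ => hWle j k)))
        exact weak_type_primeAvg_range (hfm i) (hf i) (h0 i) (hε i hi) N
    _ = ∑ i ∈ I, ((∫ x, f i x) / ε i +
        2 * ∑ j ∈ Finset.range N, ∑ k ∈ Finset.Ioc j N, ∫ x in S i j k, A i j k x) := by
        rw [Finset.sum_add_distrib]
        congr 1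
        simp only [← Finset.mul_sum]
        congr 1
        rw [Finset.sum_comm]
        rw [Finset.sum_congr rfl fun j _ => Finset.sum_comm]
    _ ≤ ∑ i ∈ I, ((∫ x, f i x) / ε i +
        2 * (2 / s i * ((∫ x, f i x) * Real.log (1 + M i / ε i)))) := by
        refine Finset.sum_le_sum fun i hi => ?_
        gcongr
        refine sum_setIntegral_primeAvg_erase_le (hfm i) (h0 i) (hM i) (hε i hi) (hs i hi)
          (hlam i hi) N (hSm i) (hSper i) ?_ ?_
        · intro j k _ _ x hx
          exact ⟨hx.2, Set.mem_iInter₂.1 hx.1.1.2 i hi⟩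
        · intro j
          exact (hWdisj j).mono fun k => Set.inter_subset_left
    _ = _ := Finset.sum_congr rfl fun i _ => by ring

end Levels

/-! ### Slices at doubly exponential heights -/

section Phi

lemma one_lt_log_three_add {x : ℝ} (hx : 0 ≤ x) : 1 < Real.log (3 + x) := by
  rw [Real.lt_log_iff_exp_lt (by linarith)]
  have := Real.exp_one_lt_d9
  linarith

lemma log_log_pos {x : ℝ} (hx : 0 ≤ x) : 0 < Real.log (Real.log (3 + x)) :=
  Real.log_pos (one_lt_log_three_add hx)

lemma Phi_nonneg {x : ℝ} (hx : 0 ≤ x) : 0 ≤ Phi x :=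
  div_nonneg (mul_nonneg hx (Real.log_nonneg (by linarith))) (log_log_pos hx).le

/-- On a slice, `49 * 2 ^ i / i` times the height is the order of magnitude of `Φ`. -/
lemma mul_le_Phi {i : ℕ} (hi : 16 ≤ i) {y : ℝ} (h1 : Real.exp (2 ^ i) < y)
    (h2 : y ≤ Real.exp (2 ^ (i + 1))) : 49 * 2 ^ i / i * y ≤ Phi (49 * y) := by
  have hi' : (16 : ℝ) ≤ i := by exact_mod_cast hi
  have hy0 : 0 < y := (Real.exp_pos _).trans h1
  have hy : 52 ≤ y := by
    have e1 : (2 : ℝ) ^ 16 ≤ 2 ^ i := pow_le_pow_right₀ (by norm_num) hi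
    have e2 := Real.add_one_le_exp ((2 : ℝ) ^ i)
    norm_num at e1
    linarith
  have hlog : (2 : ℝ) ^ i ≤ Real.log (1 + 49 * y) := by
    rw [Real.le_log_iff_exp_le (by linarith)]
    linarith
  have hll : Real.log (Real.log (3 + 49 * y)) ≤ i := by
    have e1 : 3 + 49 * y ≤ Real.exp (2 ^ (i + 2)) := by
      calc 3 + 49 * y ≤ y * y := by nlinarith
        _ ≤ Real.exp (2 ^ (i + 1)) * Real.exp (2 ^ (i + 1)) := by gcongr
        _ = Real.exp (2 ^ (i + 2)) := by rw [← Real.exp_add]; congr 1; ring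
    have e2 : Real.log (3 + 49 * y) ≤ 2 ^ (i + 2) := by
      rwa [Real.log_le_iff_le_exp (by linarith)]
    have e3 := one_lt_log_three_add (x := 49 * y) (by linarith)
    calc Real.log (Real.log (3 + 49 * y)) ≤ Real.log (2 ^ (i + 2)) :=
          Real.log_le_log (by linarith) e2
      _ = (i + 2) * Real.log 2 := by rw [Real.log_pow]; push_cast; ring
      _ ≤ (i + 2) * 0.7 := by
          gcongr
          have := Real.log_two_lt_d9
          linarith
      _ ≤ i := by linarith
  have hp := log_log_pos (x := 49 * y) (by linarith)
  have hl0 : 0 ≤ Real.log (1 + 49 * y) := Real.log_nonneg (by linarith)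
  calc 49 * 2 ^ i / i * y = 49 * y * 2 ^ i / i := by ring
    _ ≤ 49 * y * Real.log (1 + 49 * y) / Real.log (Real.log (3 + 49 * y)) := by
        have : 0 ≤ 49 * y * Real.log (1 + 49 * y) := by positivity
        gcongr
    _ = Phi (49 * y) := rfl

end Phi

section Parameters

lemma threshold_mul_exp_le {i : ℕ} (hi : 16 ≤ i) :
    (i : ℝ) / 2 ^ i * Real.exp ((i : ℝ) / 4) ≤ (4 / 5) ^ i := by
  have h1 : Real.exp ((i : ℝ) / 4) ≤ (13 / 10) ^ i := by
    have e : Real.exp (1 / 4) ≤ 13 / 10 := by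
      refine le_of_pow_le_pow_left₀ (n := 4) (by norm_num) (by norm_num) ?_
      rw [← Real.exp_nat_mul]
      have := Real.exp_one_lt_d9
      norm_num
      linarith
    calc Real.exp ((i : ℝ) / 4) = Real.exp (1 / 4) ^ i := by
          rw [← Real.exp_nat_mul]; congr 1; ring
      _ ≤ _ := by gcongr
  have h2 : (i : ℝ) ≤ (16 / 13) ^ i := by
    clear h1
    induction i, hi using Nat.le_induction with
    | base => norm_num
    | succ n hn ih =>
      have hn' : (16 : ℝ) ≤ n := by exact_mod_cast hn
      rw [pow_succ]
      push_cast
      linarith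
  calc (i : ℝ) / 2 ^ i * Real.exp ((i : ℝ) / 4) ≤ (16 / 13) ^ i / 2 ^ i * (13 / 10) ^ i := by gcongr
    _ = (4 / 5) ^ i := by rw [← div_pow, ← mul_pow]; norm_num

/-- The cost per unit of mass in the slice of index `i`, for the parameters `ε = i / 2 ^ i`,
`s = i / 4` and `M = exp 2^(i+1)`. -/
lemma coefficient_le {i : ℕ} (hi : 16 ≤ i) :
    1 / ((i : ℝ) / 2 ^ i) + 4 / ((i : ℝ) / 4) *
      Real.log (1 + Real.exp (2 ^ (i + 1)) / ((i : ℝ) / 2 ^ i)) ≤ 49 * 2 ^ i / i := by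
  have hi' : (16 : ℝ) ≤ i := by exact_mod_cast hi
  have hM : 1 ≤ Real.exp (2 ^ (i + 1)) := Real.one_le_exp (by positivity)
  have h2 : (1 : ℝ) ≤ 2 ^ i := one_le_pow₀ (by norm_num)
  have hlt : (i : ℝ) ≤ 2 ^ i := by exact_mod_cast Nat.lt_two_pow_self.le
  have h1 : 1 + Real.exp (2 ^ (i + 1)) / ((i : ℝ) / 2 ^ i) ≤
      Real.exp (2 ^ (i + 1)) * Real.exp (2 ^ i) := by
    have e1 : Real.exp (2 ^ (i + 1)) / ((i : ℝ) / 2 ^ i) ≤ Real.exp (2 ^ (i + 1)) * 2 ^ i := by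
      rw [div_div_eq_mul_div]
      exact div_le_self (by positivity) (by linarith)
    have e2 := Real.add_one_le_exp ((2 : ℝ) ^ i)
    nlinarith
  have h3 : Real.log (1 + Real.exp (2 ^ (i + 1)) / ((i : ℝ) / 2 ^ i)) ≤ 3 * 2 ^ i := by
    rw [Real.log_le_iff_le_exp (by positivity)]
    refine h1.trans (le_of_eq ?_)
    rw [← Real.exp_add]; congr 1; ring
  calc _ ≤ 1 / ((i : ℝ) / 2 ^ i) + 4 / ((i : ℝ) / 4) * (3 * 2 ^ i) := by gcongr
    _ = 49 * 2 ^ i / i := by field_simp; norm_num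

lemma sum_thresholds_le (N : ℕ) : ∑ i ∈ Finset.Ico 16 N, (4 / 5 : ℝ) ^ i ≤ 1 / 2 := by
  refine (geom_sum_Ico_le_of_lt_one (by norm_num) (by norm_num)).trans ?_
  norm_num

end Parameters

section Slices

variable {F : UnitAddCircle → ℝ}

/-- The part of `F` with values in `(exp 2^i, exp 2^(i+1)]`, on which `log F` is comparable to
`2^i` and `log log F` to `i`. -/
def slice (F : UnitAddCircle → ℝ) (i : ℕ) : UnitAddCircle → ℝ :=
  {x | Real.exp (2 ^ i) < F x ∧ F x ≤ Real.exp (2 ^ (i + 1))}.indicator F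

lemma measurable_slice (hF : Measurable F) (i : ℕ) : Measurable (slice F i) :=
  hF.indicator ((measurableSet_lt measurable_const hF).inter
    (measurableSet_le hF measurable_const))

lemma slice_nonneg (i : ℕ) (x : UnitAddCircle) : 0 ≤ slice F i x :=
  Set.indicator_nonneg (fun _ hx => (Real.exp_pos _).le.trans hx.1.le) x

lemma slice_le (i : ℕ) (x : UnitAddCircle) : slice F i x ≤ Real.exp (2 ^ (i + 1)) :=
  Set.indicator_apply_le' (fun hx => hx.2) fun _ => (Real.exp_pos _).le

/-- At each point at most one slice is nonzero. -/
lemma sum_slice_le_Phi (h0 : ∀ x, 0 ≤ F x) (N : ℕ) (x : UnitAddCircle) :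
    ∑ i ∈ Finset.Ico 16 N, 49 * 2 ^ i / (i : ℝ) * slice F i x ≤ Phi (49 * F x) := by
  have hΦ : 0 ≤ Phi (49 * F x) := Phi_nonneg (by linarith [h0 x])
  by_cases h : ∃ i ∈ Finset.Ico 16 N, Real.exp (2 ^ i) < F x ∧ F x ≤ Real.exp (2 ^ (i + 1))
  · obtain ⟨i, hi, h1, h2⟩ := h
    rw [Finset.sum_eq_single_of_mem i hi]
    · rw [slice, Set.indicator_of_mem (by exact ⟨h1, h2⟩)]
      exact mul_le_Phi (Finset.mem_Ico.1 hi).1 h1 h2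
    · intro l _ hl
      rw [slice, Set.indicator_of_notMem, mul_zero]
      rintro ⟨h3, h4⟩
      have e1 := h1.trans_le h4
      have e2 := h3.trans_le h2
      rw [Real.exp_lt_exp, pow_lt_pow_iff_right₀ (by norm_num)] at e1 e2
      omega
  · push Not at h
    rw [Finset.sum_eq_zero]
    · exact hΦ
    · intro i hi
      rw [slice, Set.indicator_of_notMem, mul_zero]
      rintro ⟨h3, h4⟩
      exact (h i hi h3).not_ge h4

/-- Values up to `exp 2^16` are not covered by the slices, all larger ones are. -/
lemma le_add_sum_slice {N : ℕ} {x : UnitAddCircle} (hx : F x ≤ Real.exp (2 ^ N)) :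
    F x ≤ Real.exp (2 ^ 16) + ∑ i ∈ Finset.Ico 16 N, slice F i x := by
  have hnn : ∀ N, 0 ≤ ∑ i ∈ Finset.Ico 16 N, slice F i x := fun N =>
    Finset.sum_nonneg fun i _ => slice_nonneg i x
  induction N with
  | zero =>
    have : F x ≤ Real.exp (2 ^ 16) := hx.trans (Real.exp_le_exp.2 (by norm_num))
    linarith [hnn 0]
  | succ N ih =>
    rcases lt_or_ge N 16 with hN | hN
    · have : F x ≤ Real.exp (2 ^ 16) := hx.trans (Real.exp_le_exp.2
        (pow_le_pow_right₀ (by norm_num) hN))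
      linarith [hnn (N + 1)]
    · rw [Finset.sum_Ico_succ_top hN]
      by_cases h : F x ≤ Real.exp (2 ^ N)
      · linarith [ih h, slice_nonneg (F := F) N x]
      · have : slice F N x = F x := Set.indicator_of_mem (by exact ⟨not_le.1 h, hx⟩) _
        linarith [hnn N, Real.exp_pos (2 ^ 16)]

/-- The maximal inequality for nonnegative functions, at a fixed large height that absorbs the
values of `F` below the slices. -/
theorem measure_exists_primeAvg_erase_le (hF : Measurable F) (h0 : ∀ x, 0 ≤ F x) :
    volume {x | ∃ k, ∃ j < k, 2 * Real.exp (2 ^ 16) < primeAvg ((Finset.range k).erase j) F x} ≤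
      ∫⁻ x, ENNReal.ofReal (Phi (49 * F x)) := by
  set D : ℕ → Set UnitAddCircle := fun N => {x | ∃ k ≤ N, ∃ j < k,
    1 < ∑ i ∈ Finset.Ico 16 N, primeAvg ((Finset.range k).erase j) (slice F i) x} with hD
  have hmono : Monotone D := by
    rintro N N' hN x ⟨k, hk, j, hj, hx⟩
    refine ⟨k, hk.trans hN, j, hj, hx.trans_le ?_⟩
    exact Finset.sum_le_sum_of_subset_of_nonneg (Finset.Ico_subset_Ico_right hN)
      fun i _ _ => avg_nonneg (slice_nonneg i) x
  have hcover : {x | ∃ k, ∃ j < k,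
      2 * Real.exp (2 ^ 16) < primeAvg ((Finset.range k).erase j) F x} ⊆ ⋃ N, D N := by
    rintro x ⟨k, j, hj, hx⟩
    set n := primeProd ((Finset.range k).erase j) with hn
    have hn0 : n ≠ 0 := primeProd_ne_zero _
    -- only finitely many values of `F` enter, so finitely many slices cover them
    obtain ⟨N, hN⟩ := exists_nat_ge
      (∑ l ∈ Finset.range n, F (x + (((l : ℝ) / (n : ℝ) : ℝ) : UnitAddCircle)))
    have hpt : ∀ l ∈ Finset.range n, F (x + (((l : ℝ) / (n : ℝ) : ℝ) : UnitAddCircle)) ≤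
        Real.exp (2 ^ (max k N)) := by
      intro l hl
      have e1 := Finset.single_le_sum (f := fun l : ℕ =>
        F (x + (((l : ℝ) / (n : ℝ) : ℝ) : UnitAddCircle))) (fun _ _ => h0 _) hl
      have e2 : (N : ℝ) ≤ (max k N : ℕ) := by exact_mod_cast le_max_right k N
      have e3 : ((max k N : ℕ) : ℝ) ≤ 2 ^ (max k N) := by exact_mod_cast Nat.lt_two_pow_self.le
      have e4 := Real.add_one_le_exp ((2 : ℝ) ^ (max k N))
      linarith
    have havg : avg n F x ≤ avg n (fun y => Real.exp (2 ^ 16) +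
        ∑ i ∈ Finset.Ico 16 (max k N), slice F i y) x := by
      unfold avg
      gcongr with l hl
      exact le_add_sum_slice (hpt l hl)
    rw [avg_add, avg_const hn0, avg_finset_sum] at havg
    refine Set.mem_iUnion.2 ⟨max k N, k, le_max_left _ _, j, hj, ?_⟩
    have e1 : 1 ≤ Real.exp (2 ^ 16) := Real.one_le_exp (by positivity)
    have hx' : 2 * Real.exp (2 ^ 16) < avg n F x := hx
    change 1 < ∑ i ∈ Finset.Ico 16 (max k N), avg n (slice F i) x
    linarith
  refine (measure_mono hcover).trans ?_
  rw [hmono.measure_iUnion]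
  refine iSup_le fun N => ?_
  have hfi : ∀ i, Integrable (slice F i) := fun i =>
    integrable_of_measurable_of_le (measurable_slice hF i) (slice_nonneg i) (slice_le i)
  have hint : ∀ i : ℕ, Integrable fun x => 49 * 2 ^ i / (i : ℝ) * slice F i x :=
    fun i => (hfi i).const_mul _
  have hreal : volume.real (D N) ≤
      ∫ x, ∑ i ∈ Finset.Ico 16 N, 49 * 2 ^ i / (i : ℝ) * slice F i x := by
    rw [integral_finsetSum _ fun i _ => hint i]
    refine (measure_exists_sum_primeAvg_erase_le (ε := fun i => (i : ℝ) / 2 ^ i)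
      (s := fun i => (i : ℝ) / 4) (lam := fun i => (4 / 5) ^ i) (measurable_slice hF)
      slice_nonneg slice_le ?_ ?_ ?_ (sum_thresholds_le N) N).trans ?_
    · intro i hi
      have : 0 < i := by have := (Finset.mem_Ico.1 hi).1; omega
      positivity
    · intro i hi
      have : (16 : ℝ) ≤ i := by exact_mod_cast (Finset.mem_Ico.1 hi).1
      linarith
    · exact fun i hi => threshold_mul_exp_le (Finset.mem_Ico.1 hi).1
    · refine Finset.sum_le_sum fun i hi => ?_
      rw [integral_const_mul]
      exact mul_le_mul_of_nonneg_right (coefficient_le (Finset.mem_Ico.1 hi).1)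
        (integral_nonneg (slice_nonneg i))
  rw [← ofReal_measureReal]
  refine (ENNReal.ofReal_le_ofReal hreal).trans ?_
  rw [ofReal_integral_eq_lintegral_ofReal (integrable_finsetSum _ fun i _ => hint i)
    (ae_of_all _ fun x => Finset.sum_nonneg fun i _ => mul_nonneg (by positivity)
      (slice_nonneg i x))]
  exact lintegral_mono fun x => ENNReal.ofReal_le_ofReal (sum_slice_le_Phi h0 N x)

end Slices

/-! ### The maximal inequality -/

section Maximal

lemma norm_R_le (n : ℕ) (f : UnitAddCircle → ℂ) (x : UnitAddCircle) :
    ‖R n f x‖ ≤ avg n (fun y => ‖f y‖) x := by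
  unfold R avg
  rw [norm_mul]
  gcongr
  · simp
  · exact norm_sum_le _ _

lemma ae_translates {p : UnitAddCircle → Prop} (hp : ∀ᵐ x, p x) :
    ∀ᵐ x : UnitAddCircle, ∀ n k : ℕ, p (x + (((k : ℝ) / (n : ℝ) : ℝ) : UnitAddCircle)) := by
  rw [ae_all_iff]; intro n
  rw [ae_all_iff]; intro k
  exact (measurePreserving_add_right volume _).quasiMeasurePreserving.ae hp

/-- The maximal inequality, with the explicit constant `98 * exp (2 ^ 16)`. -/
theorem measure_maximal_le {f : UnitAddCircle → ℂ} (hf : AEStronglyMeasurable f volume) {lam : ℝ}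
    (hlam : 0 < lam) :
    volume {x | ENNReal.ofReal lam < maximal f x} ≤
      ∫⁻ x, ENNReal.ofReal (Phi (98 * Real.exp (2 ^ 16) * ‖f x‖ / lam)) := by
  -- a measurable representative of `‖f‖`, scaled so that the height `lam` becomes `C`
  set C : ℝ := 2 * Real.exp (2 ^ 16) with hC
  have hC0 : 0 < C := by positivity
  set h : UnitAddCircle → ℝ := fun x => ‖hf.mk f x‖ with hh
  have hm : Measurable h := hf.stronglyMeasurable_mk.measurable.norm
  set F : UnitAddCircle → ℝ := fun x => C / lam * h x with hF
  have hae : ∀ᵐ x, h x = ‖f x‖ := by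
    filter_upwards [hf.ae_eq_mk] with x hx
    rw [hh]; dsimp only; rw [hx]
  calc volume {x | ENNReal.ofReal lam < maximal f x}
      ≤ volume {x | ∃ k, ∃ j < k, C < primeAvg ((Finset.range k).erase j) F x} := by
        refine measure_mono_ae ?_
        filter_upwards [ae_translates hae] with x hx hmax
        change ENNReal.ofReal lam < maximal f x at hmax
        simp only [maximal, lt_iSup_iff] at hmax
        obtain ⟨n, ⟨k, j, -, hj, hn⟩, hlt⟩ := hmax
        refine ⟨k, j, hj, ?_⟩
        rw [← ofReal_norm, ENNReal.ofReal_lt_ofReal_iff_of_nonneg hlam.le] at hlt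
        have h1 : lam < avg n h x := by
          refine hlt.trans_le ((norm_R_le n f x).trans (le_of_eq ?_))
          simp only [avg, hx]
        have h2 : primeAvg ((Finset.range k).erase j) F x = C / lam * avg n h x := by
          rw [primeAvg, primeProd, ← hn]
          simp only [avg, hF, ← Finset.mul_sum]
          ring
        rw [h2]
        calc C = C / lam * lam := by field_simp
          _ < _ := by gcongr
    _ ≤ ∫⁻ x, ENNReal.ofReal (Phi (49 * F x)) := measure_exists_primeAvg_erase_le
        (hm.const_mul _) fun x => mul_nonneg (by positivity) (norm_nonneg _)
    _ = _ := by
        refine lintegral_congr_ae ?_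
        filter_upwards [hae] with x hx
        simp only [hF, hx, hC]
        congr 2
        ring

end Maximal

/-! ### Growth of `Φ` -/

section Growth

lemma le_one_add_Phi {x : ℝ} (hx : 0 ≤ x) : x ≤ 1 + Phi x := by
  rcases le_or_gt x 1 with h | h
  · linarith [Phi_nonneg hx]
  · have h1 : Real.log (3 + x) ≤ 1 + x := by
      have e1 := Real.log_le_sub_one_of_pos (x := (3 + x) / 2) (by linarith)
      rw [Real.log_div (by linarith) (by norm_num)] at e1
      have := Real.log_two_lt_d9
      linarith
    have h2 : Real.log (Real.log (3 + x)) ≤ Real.log (1 + x) :=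
      Real.log_le_log (by linarith [one_lt_log_three_add hx]) h1
    have h3 : x ≤ Phi x := by
      rw [Phi, le_div_iff₀ (log_log_pos hx)]
      gcongr
    linarith

lemma log_log_three_le {x : ℝ} (hx : 0 ≤ x) :
    Real.log (Real.log 3) ≤ Real.log (Real.log (3 + x)) := by
  have h0 := one_lt_log_three_add le_rfl
  rw [add_zero] at h0
  exact Real.log_le_log (by linarith) (Real.log_le_log (by norm_num) (by linarith))

lemma log_log_three_pos : 0 < Real.log (Real.log 3) := by
  simpa using log_log_pos le_rfl

/-- Approximation in `L²` controls `∫ Φ`, since `Φ` is at most quadratic. -/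
lemma Phi_le_sq {x : ℝ} (hx : 0 ≤ x) : Phi x ≤ x ^ 2 / Real.log (Real.log 3) := by
  have h1 : Real.log (1 + x) ≤ x := by
    have := Real.log_le_sub_one_of_pos (x := 1 + x) (by linarith)
    linarith
  have := log_log_three_le hx
  have := log_log_three_pos
  calc Phi x ≤ x * x / Real.log (Real.log 3) := by
        rw [Phi]
        gcongr
    _ = _ := by rw [sq]

/-- The class `L^Φ` is invariant under dilations. -/
lemma exists_Phi_mul_le {K : ℝ} (hK : 1 ≤ K) : ∃ C, ∀ x, 0 ≤ x → Phi (K * x) ≤ C * (1 + Phi x) := by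
  have hl3 := log_log_three_pos
  have hl2 : 0 < Real.log 2 := Real.log_pos (by norm_num)
  have hlK : 0 ≤ Real.log (1 + K) := Real.log_nonneg (by linarith)
  refine ⟨K + K * Real.log (1 + K) * (1 / Real.log (Real.log 3) + 1 / Real.log 2), fun x hx => ?_⟩
  have hΦ := Phi_nonneg hx
  have hll := log_log_pos hx
  have hxK : x ≤ K * x := le_mul_of_one_le_left hx hK
  have h1 : Phi (K * x) ≤ K * Phi x + K * Real.log (1 + K) * (x / Real.log (Real.log (3 + x))) := by
    have e1 : Real.log (1 + K * x) ≤ Real.log (1 + x) + Real.log (1 + K) := by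
      rw [← Real.log_mul (by linarith) (by linarith)]
      exact Real.log_le_log (by positivity) (by nlinarith)
    have e2 : Real.log (Real.log (3 + x)) ≤ Real.log (Real.log (3 + K * x)) :=
      Real.log_le_log (by linarith [one_lt_log_three_add hx])
        (Real.log_le_log (by linarith) (by linarith))
    have e3 : 0 ≤ Real.log (1 + x) := Real.log_nonneg (by linarith)
    calc Phi (K * x) ≤ K * x * (Real.log (1 + x) + Real.log (1 + K)) /
          Real.log (Real.log (3 + x)) := by
          rw [Phi]
          gcongr
      _ = _ := by rw [Phi]; ring
  have h2 : x / Real.log (Real.log (3 + x)) ≤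
      (1 / Real.log (Real.log 3) + 1 / Real.log 2) * (1 + Phi x) := by
    have p3 : 0 ≤ 1 / Real.log (Real.log 3) := by positivity
    have p2 : 0 ≤ 1 / Real.log 2 := by positivity
    rcases le_or_gt x 1 with h | h
    · have : x / Real.log (Real.log (3 + x)) ≤ 1 / Real.log (Real.log 3) := by
        have := log_log_three_le hx
        gcongr
      nlinarith [mul_nonneg p3 hΦ, mul_nonneg p2 hΦ]
    · have : x / Real.log (Real.log (3 + x)) ≤ 1 / Real.log 2 * Phi x := by
        have e : Real.log 2 ≤ Real.log (1 + x) := Real.log_le_log (by norm_num) (by linarith)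
        rw [Phi, one_div_mul_eq_div, div_right_comm]
        gcongr
        rw [le_div_iff₀ hl2]
        gcongr
      nlinarith [mul_nonneg p3 hΦ, mul_nonneg p2 hΦ]
  have h3 : 0 ≤ K * Real.log (1 + K) := by positivity
  calc Phi (K * x) ≤ K * Phi x + K * Real.log (1 + K) * (x / Real.log (Real.log (3 + x))) := h1
    _ ≤ K * (1 + Phi x) + K * Real.log (1 + K) *
        ((1 / Real.log (Real.log 3) + 1 / Real.log 2) * (1 + Phi x)) := by
      gcongr
      linarith
    _ = _ := by ring

@[fun_prop]
lemma measurable_Phi : Measurable Phi := by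
  unfold Phi
  fun_prop

lemma MemLPhi.integrable {f : UnitAddCircle → ℂ} (hf : MemLPhi f) : Integrable f :=
  ((integrable_const (1 : ℝ)).add hf.2).mono' hf.1 (ae_of_all _ fun x => by
    simpa using le_one_add_Phi (norm_nonneg (f x)))

end Growth

/-! ### Almost everywhere convergence -/

section Convergence

lemma R_sub (n : ℕ) (f g : UnitAddCircle → ℂ) (x : UnitAddCircle) :
    R n (fun y => f y - g y) x = R n f x - R n g x := by
  simp only [R, Finset.sum_sub_distrib]; ring

lemma norm_R_le_of_le {n : ℕ} (hn : n ≠ 0) {f : UnitAddCircle → ℂ} {x : UnitAddCircle} {δ : ℝ}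
    (h : ∀ k : ℕ, ‖f (x + (((k : ℝ) / (n : ℝ) : ℝ) : UnitAddCircle))‖ ≤ δ) : ‖R n f x‖ ≤ δ := by
  refine (norm_R_le n f x).trans ?_
  rw [← avg_const hn δ x]
  unfold avg
  gcongr
  exact h _

lemma fracPeriodic_R {n : ℕ} (hn : n ≠ 0) (f : UnitAddCircle → ℂ) : FracPeriodic n (R n f) := by
  intro x
  rw [R, sum_translates_add hn, R]

lemma integrable_R (n : ℕ) {f : UnitAddCircle → ℂ} (hf : Integrable f) : Integrable (R n f) := by
  unfold R
  exact (integrable_finsetSum _ fun k _ => hf.comp_add_right _).const_mul _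

lemma integral_R {n : ℕ} (hn : n ≠ 0) {f : UnitAddCircle → ℂ} (hf : Integrable f) :
    ∫ x, R n f x = ∫ x, f x := by
  have hn' : (n : ℂ) ≠ 0 := by exact_mod_cast hn
  unfold R
  rw [integral_const_mul, integral_finsetSum _ fun k _ => hf.comp_add_right _]
  simp_rw [integral_add_right_eq_self]
  simp; field_simp

/-- The translates of a point by multiples of `1/n` form a `1/n`-net. -/
lemma exists_dist_add_div_le {n : ℕ} (hn : n ≠ 0) (x y : UnitAddCircle) :
    ∃ k : ℕ, dist x (y + (((k : ℝ) / (n : ℝ) : ℝ) : UnitAddCircle)) ≤ 1 / n := by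
  have hn' : (0 : ℝ) < n := by exact_mod_cast Nat.pos_of_ne_zero hn
  obtain ⟨r, hr, rfl⟩ := AddCircle.eq_coe_Ico (y)
  obtain ⟨t, ht, rfl⟩ := AddCircle.eq_coe_Ico (x)
  have e : ((t : ℝ) : UnitAddCircle) = ((t + 1 : ℝ) : UnitAddCircle) := by
    rw [AddCircle.coe_add, AddCircle.coe_period, add_zero]
  have hpos : 0 ≤ t + 1 - r := by linarith [hr.2, ht.1]
  refine ⟨⌊(t + 1 - r) * n⌋₊, ?_⟩
  rw [e, ← AddCircle.coe_add, dist_eq_norm, ← AddCircle.coe_sub]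
  rw [UnitAddCircle.norm_eq]
  refine (round_le _ 0).trans ?_
  rw [Int.cast_zero, sub_zero]
  have h1 := Nat.floor_le (mul_nonneg hpos hn'.le)
  have h2 := Nat.lt_floor_add_one ((t + 1 - r) * n)
  rw [abs_le]
  constructor
  · have : (⌊(t + 1 - r) * n⌋₊ : ℝ) / n ≤ t + 1 - r := by rwa [div_le_iff₀ hn']
    have : 0 ≤ 1 / (n : ℝ) := by positivity
    linarith
  · have : t + 1 - r ≤ (⌊(t + 1 - r) * n⌋₊ + 1 : ℝ) / n := by rw [le_div_iff₀ hn']; exact h2.le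
    rw [add_div] at this
    linarith

lemma tendsto_R_of_continuous {f : UnitAddCircle → ℂ} (hf : Continuous f) (x : UnitAddCircle) :
    Tendsto (fun n : ℕ => R n f x) atTop (𝓝 (∫ y, f y)) := by
  have hfi : Integrable f := hf.integrable_of_hasCompactSupport (.of_compactSpace f)
  rw [Metric.tendsto_atTop]
  intro δ hδ
  obtain ⟨η, hη, hu⟩ := Metric.uniformContinuous_iff.1
    (CompactSpace.uniformContinuous_of_continuous hf) (δ / 2) (half_pos hδ)
  obtain ⟨N, hN⟩ := exists_nat_one_div_lt hη
  refine ⟨N + 1, fun n hn => ?_⟩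
  have hn0 : n ≠ 0 := by omega
  have hnη : 1 / (n : ℝ) < η := by
    refine lt_of_le_of_lt ?_ hN
    gcongr
    exact_mod_cast hn
  -- `R n f` is periodic with period `1/n`, so its oscillation is that of `f` at scale `1/n`
  have hosc : ∀ y, ‖R n f x - R n f y‖ ≤ δ / 2 := by
    intro y
    obtain ⟨k, hk⟩ := exists_dist_add_div_le hn0 x y
    rw [← (fracPeriodic_R hn0 f).apply_add_div y k]
    set z := y + (((k : ℝ) / (n : ℝ) : ℝ) : UnitAddCircle)
    have : R n f x - R n f z = R n (fun w => f w - f (w + (z - x))) x := by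
      rw [R_sub]
      congr 1
      simp only [R]
      congr 1
      refine Finset.sum_congr rfl fun l _ => ?_
      congr 1
      abel
    rw [this]
    refine norm_R_le_of_le hn0 fun l => ?_
    rw [← dist_eq_norm]
    refine (hu ?_).le
    rw [dist_comm, dist_self_add_left, ← dist_eq_norm, dist_comm]
    exact hk.trans_lt hnη
  have heq : R n f x - ∫ y, f y = ∫ y, (R n f x - R n f y) := by
    rw [integral_sub (integrable_const _) (integrable_R n hfi), integral_R hn0 hfi]
    simp
  rw [dist_eq_norm, heq]
  refine lt_of_le_of_lt (norm_integral_le_of_norm_le_const (ae_of_all _ hosc)) ?_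
  rw [probReal_univ]
  linarith

/-- The Riemann sums of `f` along `E` converge to the integral of `f` almost everywhere. -/
def AEConverges (f : UnitAddCircle → ℂ) : Prop :=
  ∀ᵐ x : UnitAddCircle, Tendsto (fun n : ℕ => R n f x) (atTop ⊓ 𝓟 E) (𝓝 (∫ y, f y))

lemma AEConverges.congr {f g : UnitAddCircle → ℂ} (hg : AEConverges g) (h : f =ᵐ[volume] g) :
    AEConverges f := by
  have hI : ∫ y, f y = ∫ y, g y := integral_congr_ae h
  filter_upwards [hg, ae_translates h] with x hx hfg
  rw [hI]
  refine hx.congr fun n => ?_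
  simp only [R, hfg]

/-- The Banach principle: almost everywhere convergence passes to limits in the sense of the maximal
inequality. -/
theorem AEConverges.of_approx {f : UnitAddCircle → ℂ}
    (h : ∀ δ > 0, δ ≤ 1 → ∃ g, AEConverges g ∧ AEStronglyMeasurable (fun x => f x - g x) volume ∧
      ‖(∫ x, f x) - ∫ x, g x‖ ≤ δ ∧
      ∫⁻ x, ENNReal.ofReal (Phi (98 * Real.exp (2 ^ 16) * ‖f x - g x‖ / δ)) ≤ ENNReal.ofReal δ) :
    AEConverges f := by
  set B : ℝ → Set UnitAddCircle := fun δ =>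
    {x | ¬ ∀ᶠ n in atTop ⊓ 𝓟 E, ‖R n f x - ∫ y, f y‖ ≤ 3 * δ} with hB
  have hBmono : ∀ {δ δ' : ℝ}, δ' ≤ δ → B δ ⊆ B δ' := by
    intro δ δ' hδ x hx hx'
    exact hx (hx'.mono fun n hn => hn.trans (by linarith))
  have hBle : ∀ δ > 0, δ ≤ 1 → volume (B δ) ≤ ENNReal.ofReal δ := by
    intro δ hδ hδ1
    obtain ⟨g, hg, hm, hint, hPhi⟩ := h δ hδ hδ1
    refine le_trans (measure_mono_ae ?_) ((measure_maximal_le hm hδ).trans hPhi)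
    filter_upwards [hg] with x hx hxB
    by_contra hmax
    refine hxB ?_
    have hmax' : maximal (fun x => f x - g x) x ≤ ENNReal.ofReal δ := not_lt.1 hmax
    have h1 : ∀ᶠ n in atTop ⊓ 𝓟 E, ‖R n g x - ∫ y, g y‖ ≤ δ := by
      filter_upwards [Metric.tendsto_nhds.1 hx δ hδ] with n hn
      rw [dist_eq_norm] at hn
      exact hn.le
    have h2 : ∀ᶠ n in atTop ⊓ 𝓟 E, n ∈ E := mem_inf_of_right (mem_principal_self E)
    filter_upwards [h1, h2] with n hn1 hn2
    have h3 : ‖R n f x - R n g x‖ ≤ δ := by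
      rw [← R_sub, ← ENNReal.ofReal_le_ofReal_iff hδ.le, ofReal_norm]
      exact (le_iSup₂ (f := fun n (_ : n ∈ E) => ‖R n (fun x => f x - g x) x‖ₑ) n hn2).trans hmax'
    calc ‖R n f x - ∫ y, f y‖ = ‖(R n f x - R n g x) + (R n g x - ∫ y, g y) -
          ((∫ y, f y) - ∫ y, g y)‖ := by congr 1; ring
      _ ≤ ‖R n f x - R n g x‖ + ‖R n g x - ∫ y, g y‖ + ‖(∫ y, f y) - ∫ y, g y‖ :=
          (norm_sub_le _ _).trans (by gcongr; exact norm_add_le _ _)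
      _ ≤ 3 * δ := by linarith
  -- the bound `δ` on the measure of `B δ` improves to `0`, since `B δ` grows as `δ` decreases
  have hBnull : ∀ δ > 0, volume (B δ) = 0 := by
    intro δ hδ
    refine le_antisymm (le_of_forall_gt_imp_ge_of_dense fun a ha => ?_) zero_le
    by_cases hat : a = ∞
    · simp [hat]
    have ha' : 0 < a.toReal := ENNReal.toReal_pos ha.ne' hat
    calc volume (B δ) ≤ volume (B (min δ (min 1 a.toReal))) :=
          measure_mono (hBmono (min_le_left _ _))
      _ ≤ ENNReal.ofReal (min δ (min 1 a.toReal)) :=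
          hBle _ (lt_min hδ (lt_min one_pos ha')) ((min_le_right _ _).trans (min_le_left _ _))
      _ ≤ ENNReal.ofReal a.toReal :=
          ENNReal.ofReal_le_ofReal ((min_le_right _ _).trans (min_le_right _ _))
      _ = a := ENNReal.ofReal_toReal hat
  have hall : ∀ᵐ x : UnitAddCircle, ∀ m : ℕ, x ∉ B (1 / ((m : ℝ) + 1)) := by
    rw [ae_all_iff]
    exact fun m => measure_eq_zero_iff_ae_notMem.1 (hBnull _ (by positivity))
  filter_upwards [hall] with x hx
  rw [Metric.tendsto_nhds]
  intro δ hδ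
  obtain ⟨m, hm⟩ := exists_nat_one_div_lt (show 0 < δ / 3 by positivity)
  have := not_not.1 (hx m)
  filter_upwards [this] with n hn
  rw [dist_eq_norm]
  linarith

lemma aeConverges_of_bounded {f : UnitAddCircle → ℂ} (hf : AEStronglyMeasurable f volume) {T : ℝ}
    (hT : ∀ x, ‖f x‖ ≤ T) : AEConverges f := by
  have hL2 : MemLp f 2 volume := .of_bound hf T (ae_of_all _ hT)
  have hfi : Integrable f := hL2.integrable (by norm_num)
  refine AEConverges.of_approx fun δ hδ _ => ?_
  set K : ℝ := 98 * Real.exp (2 ^ 16) / δ with hK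
  set a : ℝ := K ^ 2 / Real.log (Real.log 3) with ha
  have hl3 := log_log_three_pos
  have hK0 : 0 < K := by positivity
  have ha0 : 0 < a := by positivity
  set ρ : ℝ := min δ (Real.sqrt (δ / a)) with hρ
  have hρ0 : 0 < ρ := lt_min hδ (Real.sqrt_pos.2 (by positivity))
  obtain ⟨g, hg, hgL2⟩ := hL2.exists_boundedContinuous_eLpNorm_sub_le (by norm_num)
    (ε := ENNReal.ofReal ρ) (by simpa using hρ0)
  have hgi : Integrable g := hgL2.integrable (by norm_num)
  have hgc : Continuous g := g.continuous
  have hsub : AEStronglyMeasurable (fun x => f x - g x) volume := hf.sub hgL2.1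
  refine ⟨g, ae_of_all _ fun x => (tendsto_R_of_continuous hgc x).mono_left inf_le_left, hsub,
    ?_, ?_⟩
  · rw [← integral_sub hfi hgi, ← ENNReal.ofReal_le_ofReal_iff hδ.le, ofReal_norm]
    calc ‖∫ x, (f x - g x)‖ₑ ≤ ∫⁻ x, ‖f x - g x‖ₑ := enorm_integral_le_lintegral_enorm _
      _ = eLpNorm (f - ⇑g) 1 volume := by rw [eLpNorm_one_eq_lintegral_enorm]; rfl
      _ ≤ eLpNorm (f - ⇑g) 2 volume := eLpNorm_le_eLpNorm_of_exponent_le (by norm_num) hsub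
      _ ≤ ENNReal.ofReal ρ := hg
      _ ≤ ENNReal.ofReal δ := ENNReal.ofReal_le_ofReal (min_le_left _ _)
  · have h2 : ∫⁻ x, ‖f x - g x‖ₑ ^ 2 ≤ ENNReal.ofReal ρ ^ 2 := by
      have := eLpNorm_nnreal_pow_eq_lintegral (f := f - ⇑g) (μ := (volume : Measure UnitAddCircle))
        (p := 2) (by norm_num)
      simp only [NNReal.coe_ofNat, ENNReal.coe_ofNat, ENNReal.rpow_ofNat, Pi.sub_apply] at this
      rw [← this]
      gcongr
    calc ∫⁻ x, ENNReal.ofReal (Phi (98 * Real.exp (2 ^ 16) * ‖f x - g x‖ / δ))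
        ≤ ∫⁻ x, ENNReal.ofReal a * ‖f x - g x‖ₑ ^ 2 := by
          refine lintegral_mono fun x => ?_
          rw [← ofReal_norm, ← ENNReal.ofReal_pow (norm_nonneg _), ← ENNReal.ofReal_mul ha0.le]
          refine ENNReal.ofReal_le_ofReal ((Phi_le_sq (by positivity)).trans (le_of_eq ?_))
          rw [ha, hK]; ring
      _ = ENNReal.ofReal a * ∫⁻ x, ‖f x - g x‖ₑ ^ 2 :=
          lintegral_const_mul' _ _ ENNReal.ofReal_ne_top
      _ ≤ ENNReal.ofReal a * ENNReal.ofReal ρ ^ 2 := by gcongr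
      _ = ENNReal.ofReal (a * ρ ^ 2) := by
          rw [← ENNReal.ofReal_pow hρ0.le, ← ENNReal.ofReal_mul ha0.le]
      _ ≤ ENNReal.ofReal δ := by
          refine ENNReal.ofReal_le_ofReal ?_
          have : ρ ^ 2 ≤ δ / a := by
            calc ρ ^ 2 ≤ Real.sqrt (δ / a) ^ 2 := by gcongr; exact min_le_right _ _
              _ = δ / a := Real.sq_sqrt (by positivity)
          calc a * ρ ^ 2 ≤ a * (δ / a) := by gcongr
            _ = δ := by field_simp

theorem MemLPhi.aeConverges {f : UnitAddCircle → ℂ} (hf : MemLPhi f) : AEConverges f := by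
  wlog hsm : StronglyMeasurable f generalizing f
  · refine (this (f := hf.1.mk f) ⟨hf.1.stronglyMeasurable_mk.aestronglyMeasurable, ?_⟩
      hf.1.stronglyMeasurable_mk).congr hf.1.ae_eq_mk
    refine hf.2.congr ?_
    filter_upwards [hf.1.ae_eq_mk] with x hx
    rw [hx]
  have hfi := hf.integrable
  set g : ℕ → UnitAddCircle → ℂ := fun T => {x | ‖f x‖ ≤ T}.indicator f with hg
  have hset : ∀ T : ℕ, MeasurableSet {x | ‖f x‖ ≤ T} := fun T =>
    measurableSet_le hsm.measurable.norm measurable_const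
  have hgsm : ∀ T, StronglyMeasurable (g T) := fun T => hsm.indicator (hset T)
  have hgconv : ∀ T, AEConverges (g T) := fun T =>
    aeConverges_of_bounded (hgsm T).aestronglyMeasurable (T := T) fun x => by
      simp only [hg, Set.indicator_apply, Set.mem_ofPred_eq]
      split_ifs with h
      · exact h
      · simp
  have hgev : ∀ x, ∀ᶠ T in atTop, g T x = f x := by
    intro x
    obtain ⟨N, hN⟩ := exists_nat_ge ‖f x‖
    filter_upwards [eventually_ge_atTop N] with T hT
    have hmem : x ∈ {x | ‖f x‖ ≤ (T : ℝ)} := hN.trans (by exact_mod_cast hT)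
    exact Set.indicator_of_mem hmem f
  have hgi : ∀ T, Integrable (g T) := fun T => hfi.indicator (hset T)
  refine AEConverges.of_approx fun δ hδ hδ1 => ?_
  have hI : Tendsto (fun T => ∫ x, g T x) atTop (𝓝 (∫ x, f x)) := by
    refine tendsto_integral_of_dominated_convergence (fun x => ‖f x‖)
      (fun T => (hgi T).1) hfi.norm (fun T => ae_of_all _ fun x => ?_)
      (ae_of_all _ fun x => tendsto_const_nhds.congr' ((hgev x).mono fun T h => h.symm))
    simp only [hg, Set.indicator_apply]
    split_ifs <;> simp
  set K : ℝ := 98 * Real.exp (2 ^ 16) / δ with hK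
  have hK1 : 1 ≤ K := by
    rw [hK, le_div_iff₀ hδ]
    have : 1 ≤ Real.exp (2 ^ 16) := Real.one_le_exp (by positivity)
    linarith
  obtain ⟨C, hC⟩ := exists_Phi_mul_le hK1
  have hP : Tendsto (fun T => ∫⁻ x, ENNReal.ofReal (Phi (K * ‖f x - g T x‖))) atTop (𝓝 0) := by
    have hbound : Integrable fun x => C * (1 + Phi ‖f x‖) :=
      ((integrable_const (1 : ℝ)).add hf.2).const_mul C
    have hlim := tendsto_lintegral_of_dominated_convergence (μ := (volume : Measure UnitAddCircle))
      (F := fun T x => ENNReal.ofReal (Phi (K * ‖f x - g T x‖))) (f := fun _ => 0)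
      (fun x => ENNReal.ofReal (C * (1 + Phi ‖f x‖))) (fun T => ?_)
      (fun T => ae_of_all _ fun x => ?_) hbound.lintegral_lt_top.ne (ae_of_all _ fun x => ?_)
    · simpa using hlim
    · exact (measurable_Phi.comp ((hsm.sub (hgsm T)).measurable.norm.const_mul K)).ennreal_ofReal
    · refine ENNReal.ofReal_le_ofReal ?_
      have h1 := hC _ (norm_nonneg (f x))
      have h2 : 0 ≤ Phi (K * ‖f x‖) := Phi_nonneg (by positivity)
      simp only [hg, Set.indicator_apply]
      split_ifs
      · simpa [Phi] using h2.trans h1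
      · simpa using h1
    · refine tendsto_const_nhds.congr' ?_
      filter_upwards [hgev x] with T hT
      simp [hT, Phi]
  have hev1 : ∀ᶠ T in atTop, ‖(∫ x, f x) - ∫ x, g T x‖ ≤ δ := by
    filter_upwards [Metric.tendsto_nhds.1 hI δ hδ] with T hT
    rw [dist_comm, dist_eq_norm] at hT
    exact hT.le
  have hev2 := hP.eventually (eventually_le_nhds (ENNReal.ofReal_pos.2 hδ))
  obtain ⟨T, h1, h2⟩ := (hev1.and hev2).exists
  refine ⟨g T, hgconv T, (hsm.sub (hgsm T)).aestronglyMeasurable, h1, le_trans (le_of_eq ?_) h2⟩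
  refine lintegral_congr fun x => ?_
  congr 2
  rw [hK]; ring

end Convergence

end

end RiemannSums

theorem theorem2 :
    (∀ f : UnitAddCircle → ℂ, RiemannSums.MemLPhi f →
      Integrable f volume ∧
      ∀ᵐ x : UnitAddCircle ∂volume,
        Tendsto (fun n : ℕ => RiemannSums.R n f x) (atTop ⊓ 𝓟 RiemannSums.E)
          (𝓝 (∫ y : UnitAddCircle, f y ∂volume))) ∧
    (∃ c : ℝ, 0 < c ∧
      ∀ f : UnitAddCircle → ℂ, RiemannSums.MemLPhi f → ∀ lam : ℝ, 0 < lam →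
        volume {x : UnitAddCircle | ENNReal.ofReal lam < RiemannSums.maximal f x} ≤
          ∫⁻ x : UnitAddCircle, ENNReal.ofReal (RiemannSums.Phi (c * ‖f x‖ / lam)) ∂volume) :=
  ⟨fun _ hf => ⟨hf.integrable, hf.aeConverges⟩,
    98 * Real.exp (2 ^ 16), by positivity, fun _ hf _ hlam =>
      RiemannSums.measure_maximal_le hf.1 hlam⟩
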